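/- Let $\alpha,\beta>-1$ and let $m\ge 0$ be an integer. For $\gamma=\pm\frac12$ put $$\mathcal W_{\alpha,\beta,\gamma}(x,y)=|x-y|^{2\alpha+1}|x+y|^{2\beta+1}(1-x^2)^{\gamma}(1-y^2)^{\gamma},\qquad (x,y)\in[-1,1]^2,$$ and let $\mathcal W^*_{\alpha,\beta,\gamma}$ be the constant multiple of $\mathcal W_{\alpha,\beta,\gamma}$ with integral $1$ over $[-1,1]^2$. Let $w^*_{a,b}$ be the Jacobi weight $(1-t)^a(1+t)^b$ normalized to have integral $1$ over $[-1,1]$, let $P_i^{(a,b)}$ be the Jacobi polynomials, $p_i^{(a,b)}$ the corresponding orthonormal polynomials with respect to $w^*_{a,b}$, and let $(c)_n=c(c+1)\cdots(c+n-1)$. A cubature rule of degree $s$ for a weight is a finite linear combination, with nonzero coefficients, of point evaluations at its nodes that equals the integral against the weight for all polynomials in two variables of total degree at most $s$, but not for all polynomials of total degree at most $s+1$. Put $N_{\min}(n)=\frac{n(n+1)}2+\lfloor\frac n2\rfloor$; a rule of degree $2n-1$ with $N_{\min}(n)+1$ nodes is called near minimal. The polynomial $P_m^{(\alpha+1,\beta)}$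 has exactly $m$ distinct real zeros, all in $(-1,1)$, so that there are unique $0=\theta_0<\theta_1<\dots<\theta_m<\pi$ such that $\cos\theta_1,\dots,\cos\theta_m$ are its real zeros. Define $$\mu_0=\frac{(\beta+1)_m}{\binom{m+\alpha+1}{m}(\alpha+\beta+2)_m},\qquad \mu_k=\frac{2(\alpha+1)}{\alpha+\beta+2}\cdot\frac{\lambda_k}{1-\cos\theta_k},\qquad \lambda_k=\Big[\sum_{i=0}^{m-1}p_i^{(\alpha+1,\beta)}(\cos\theta_k)^2\Big]^{-1}\quad(1\le k\le m).$$ These are the Gauss--Radau weights: $\int_{-1}^1 f(t)\,w^*_{\alpha,\beta}(t)\,dt=\sum_{k=0}^m\mu_k f(\cos\theta_k)$ for every polynomial $f$ of degree at most $2m$. For $0\le j\le k\le m$ let $$s_{j,k}=\cos\tfrac{\theta_j-\theta_k}2,\qquad t_{j,k}=\cos\tfrac{\theta_j+\theta_k}2,$$ $$S_{j,k}[f]=f(s_{j,k},t_{j,k})+f(t_{j,k},s_{j,k})+f(-s_{j,k},-t_{j,k})+f(-t_{j,k},-s_{j,k}),$$ and let $\sum'$ mean that the terms with $j=k$ are halved.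 (i) The functional $$f\mapsto\frac12\sum_{k=0}^m{\sum_{j=0}^k}'\mu_k\mu_j\,S_{j,k}[f]$$ is a near minimal cubature rule of degree $4m+1$ for $\mathcal W^*_{\alpha,\beta,-1/2}$; its nodes are the points $(s_{j,k},t_{j,k})$, $(t_{j,k},s_{j,k})$, $(-s_{j,k},-t_{j,k})$, $(-t_{j,k},-s_{j,k})$ with $0\le j\le k\le m$, and their number is $N_{\min}(2m+1)+1$. (ii) If $m\ge1$, the functional $$f\mapsto\frac{(\alpha+\beta+2)^2(\alpha+\beta+3)}{8(\alpha+1)(\beta+1)}\cdot\frac12\sum_{k=0}^m{\sum_{j=0}^k}'\mu_k\mu_j(\cos\theta_j-\cos\theta_k)^2\,S_{j,k}[f]$$ is a near minimal cubature rule of degree $4m-3$ for $\mathcal W^*_{\alpha,\beta,1/2}$; its nodes are the points of the same form with $0\le j<k\le m$, and their number is $N_{\min}(2m-1)+1$. -/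

import Mathlib

open MeasureTheory

noncomputable section

namespace XuCubature

/-! ### Jacobi polynomials, Christoffel functions, Gauss-Radau weights -/

/-- The Jacobi polynomial `P_n^{(a,b)}` (standard normalization,
`P_n^{(a,b)}(1) = (a+1)_n / n!`), expanded at `1`:
`P_n^{(a,b)}(x) = (1/n!) ∑_k C(n,k) (n+a+b+1)_k (a+k+1)_{n-k} ((x-1)/2)^k`. -/
def jacobi (a b : ℝ) (n : ℕ) : Polynomial ℝ :=
  ∑ k ∈ Finset.range (n + 1),
    Polynomial.C ((n.choose k : ℝ) * (ascPochhammer ℝ k).eval (n + a + b + 1) *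
      (ascPochhammer ℝ (n - k)).eval (a + k + 1) / (n.factorial : ℝ)) *
    (Polynomial.C (1 / 2) * (Polynomial.X - 1)) ^ k

/-- The Jacobi weight `w_{a,b}(t) = (1-t)^a (1+t)^b`. -/
def jacobiWeight (a b : ℝ) (t : ℝ) : ℝ := (1 - t) ^ a * (1 + t) ^ b

/-- The integral of `f` over `[-1,1]` against the Jacobi weight normalized to have integral `1`. -/
def jacobiMean (a b : ℝ) (f : ℝ → ℝ) : ℝ :=
  (∫ t in (-1 : ℝ)..1, f t * jacobiWeight a b t) / ∫ t in (-1 : ℝ)..1, jacobiWeight a b t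

/-- The Christoffel function `1 / ∑_{i<n} p_i(x)^2` of the normalized Jacobi weight, where
`p_i = P_i / ‖P_i‖` are the orthonormal Jacobi polynomials. At a zero of `P_n^{(a,b)}`
its value is the corresponding weight of the `n`-point Gauss quadrature rule. -/
def christoffel (a b : ℝ) (n : ℕ) (x : ℝ) : ℝ :=
  (∑ i ∈ Finset.range n, ((jacobi a b i).eval x) ^ 2 /
    jacobiMean a b (fun t => ((jacobi a b i).eval t) ^ 2))⁻¹

/-- `θ` lists the angles `0 = θ_0 < θ_1 < ... < θ_m < π`, where `cos θ_1, ..., cos θ_m` are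
all the (real) zeros of `P_m^{(α+1,β)}`. -/
structure IsRadauAngles (α β : ℝ) (m : ℕ) (θ : Fin (m + 1) → ℝ) : Prop where
  zero : θ 0 = 0
  strictMono : StrictMono θ
  lt_pi : ∀ k, θ k < Real.pi
  zeros : ∀ x : ℝ, (jacobi (α + 1) β m).IsRoot x ↔ ∃ k, k ≠ 0 ∧ x = Real.cos (θ k)

/-- The Gauss-Radau weights `μ_{k,m}^{(α,β)}`:
`μ_0 = (β+1)_m / (C(m+α+1,m) (α+β+2)_m)`, with `C(m+α+1,m) = (α+2)_m / m!`, and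
`μ_k = 2(α+1)/(α+β+2) * λ_k^{(α+1,β)} / (1 - cos θ_k)` for `k ≥ 1`. -/
def radauWeight (α β : ℝ) (m : ℕ) (θ : Fin (m + 1) → ℝ) (k : Fin (m + 1)) : ℝ :=
  if k = 0 then
    (ascPochhammer ℝ m).eval (β + 1) /
      ((ascPochhammer ℝ m).eval (α + 2) / (m.factorial : ℝ) *
        (ascPochhammer ℝ m).eval (α + β + 2))
  else
    2 * (α + 1) / (α + β + 2) *
      (christoffel (α + 1) β m (Real.cos (θ k)) / (1 - Real.cos (θ k)))

/-! ### The weight functions on the square -/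

/-- The square `[-1,1]^2`. -/
def square : Set (ℝ × ℝ) := Set.Icc (-1) 1 ×ˢ Set.Icc (-1) 1

/-- `𝒲_{α,β,γ}(x,y) = |x-y|^{2α+1} |x+y|^{2β+1} (1-x²)^γ (1-y²)^γ`. -/
def cubeWeight (α β γ : ℝ) (p : ℝ × ℝ) : ℝ :=
  |p.1 - p.2| ^ (2 * α + 1) * |p.1 + p.2| ^ (2 * β + 1) *
    (1 - p.1 ^ 2) ^ γ * (1 - p.2 ^ 2) ^ γ

/-- `𝒲*_{α,β,γ}`: the weight normalized to have integral `1` over the square. -/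
def normCubeWeight (α β γ : ℝ) (p : ℝ × ℝ) : ℝ :=
  cubeWeight α β γ p / ∫ q in square, cubeWeight α β γ q

/-! ### Cubature rules -/

/-- The function on the plane given by a real polynomial in two variables. -/
def evalPoly (f : MvPolynomial (Fin 2) ℝ) (p : ℝ × ℝ) : ℝ := MvPolynomial.eval ![p.1, p.2] f

/-- The functional `C` is a cubature rule of degree `s` for the weight `W` on `Ω`, with
`X` as its set of nodes: it is a linear combination with nonzero coefficients of the point
evaluations at `X`, it equals the integral for all polynomials of total degree at most `s`,
and it differs from it for some polynomial of total degree at most `s + 1`. -/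
structure IsCubatureRule (Ω : Set (ℝ × ℝ)) (W : ℝ × ℝ → ℝ) (s : ℕ)
    (X : Finset (ℝ × ℝ)) (C : (ℝ × ℝ → ℝ) → ℝ) : Prop where
  weights : ∃ w : ℝ × ℝ → ℝ, (∀ p ∈ X, w p ≠ 0) ∧ ∀ f, C f = ∑ p ∈ X, w p * f p
  integrable : ∀ f : MvPolynomial (Fin 2) ℝ, IntegrableOn (fun p => evalPoly f p * W p) Ω
  exact : ∀ f : MvPolynomial (Fin 2) ℝ, f.totalDegree ≤ s →
    ∫ p in Ω, evalPoly f p * W p = C (evalPoly f)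
  sharp : ∃ f : MvPolynomial (Fin 2) ℝ, f.totalDegree ≤ s + 1 ∧
    ∫ p in Ω, evalPoly f p * W p ≠ C (evalPoly f)

/-- The lower bound `N_min(n) = dim Π_{n-1}^2 + ⌊n/2⌋ = n(n+1)/2 + ⌊n/2⌋` for the number of
nodes of a cubature rule of degree `2n-1` for a centrally symmetric weight. -/
def nMin (n : ℕ) : ℕ := n * (n + 1) / 2 + n / 2

/-! ### The explicit rules -/

section rules

variable {m : ℕ} (θ : Fin (m + 1) → ℝ)

/-- `s_{j,k} = cos ((θ_j - θ_k)/2)`. -/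
def sNode (j k : Fin (m + 1)) : ℝ := Real.cos ((θ j - θ k) / 2)

/-- `t_{j,k} = cos ((θ_j + θ_k)/2)`. -/
def tNode (j k : Fin (m + 1)) : ℝ := Real.cos ((θ j + θ k) / 2)

/-- The points `(s,t)`, `(t,s)`, `(-s,-t)`, `(-t,-s)` for `s = s_{j,k}`, `t = t_{j,k}`. -/
def orbit (j k : Fin (m + 1)) : Finset (ℝ × ℝ) :=
  {(sNode θ j k, tNode θ j k), (tNode θ j k, sNode θ j k),
    (-sNode θ j k, -tNode θ j k), (-tNode θ j k, -sNode θ j k)}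

/-- `f(s,t) + f(t,s) + f(-s,-t) + f(-t,-s)` for `s = s_{j,k}`, `t = t_{j,k}`. -/
def orbitSum (f : ℝ × ℝ → ℝ) (j k : Fin (m + 1)) : ℝ :=
  f (sNode θ j k, tNode θ j k) + f (tNode θ j k, sNode θ j k) +
    f (-sNode θ j k, -tNode θ j k) + f (-tNode θ j k, -sNode θ j k)

/-- All points with `0 ≤ j ≤ k ≤ m`. -/
def nodesMinus : Finset (ℝ × ℝ) :=
  Finset.univ.biUnion fun k => (Finset.Iic k).biUnion fun j => orbit θ j k

/-- All points with `0 ≤ j < k ≤ m`. -/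
def nodesPlus : Finset (ℝ × ℝ) :=
  Finset.univ.biUnion fun k => (Finset.Iio k).biUnion fun j => orbit θ j k

/-- `½ ∑_{k=0}^m ∑'_{j=0}^k μ_k μ_j [f(s,t) + f(t,s) + f(-s,-t) + f(-t,-s)]`, the terms with
`j = k` being halved. -/
def ruleMinus (α β : ℝ) (f : ℝ × ℝ → ℝ) : ℝ :=
  1 / 2 * ∑ k, ∑ j ∈ Finset.Iic k, (if j = k then 1 / 2 else 1) *
    (radauWeight α β m θ k * radauWeight α β m θ j) * orbitSum θ f j k

/-- The same sum with the additional factors `(cos θ_j - cos θ_k)²` (so that the terms with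
`j = k` vanish) and the constant `(α+β+2)²(α+β+3) / (8(α+1)(β+1))`, which is the ratio of the
integrals of `𝒲_{α,β,-1/2}` and `4 𝒲_{α,β,1/2}`. -/
def rulePlus (α β : ℝ) (f : ℝ × ℝ → ℝ) : ℝ :=
  (α + β + 2) ^ 2 * (α + β + 3) / (8 * (α + 1) * (β + 1)) *
    (1 / 2 * ∑ k, ∑ j ∈ Finset.Iic k, (if j = k then 1 / 2 else 1) *
      (radauWeight α β m θ k * radauWeight α β m θ j) *
      (Real.cos (θ j) - Real.cos (θ k)) ^ 2 * orbitSum θ f j k)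

end rules

end XuCubature

end

/-!
# Near minimal cubature rules from Gauss-Radau quadrature

The substitution `x = cos ((θ-φ)/2)`, `y = cos ((θ+φ)/2)` gives, with `u = cos θ` and `v = cos φ`,
`(x+y)² = (1+u)(1+v)`, `(x-y)² = (1-u)(1-v)` and `4(1-x²)(1-y²) = (u-v)²`.

For `γ = -1/2` the total mass of the weight on the square is the square of the mass
`∫ (1-t)^α (1+t)^β dt` of the Jacobi weight (`lintegral_cubeWeight`): with `x = cos s`, `y = cos r`
the integrand is periodic in both variables, and a rotation, carried out by two shifts, makes it a
product. As multiplication by `(x+y)^(2i) (x-y)^(2j)` only changes `α` and `β` to `α+j` and `β+i`,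
the integral of this function against the normalized weight is the square of the mean of
`(1+t)^i (1-t)^j` against the normalized Jacobi weight (`squareL_diagMonomial_even`). The rule takes
on it the square of the Gauss-Radau sum of the same function (`ruleL_diagMonomial_even`), and both
vanish on `(x+y)^i (x-y)^j` if `i` or `j` is odd. These functions with `i + j ≤ s` span the
polynomials of degree at most `s`, so exactness of the Radau rule up to degree `2m` yields exactness
up to degree `4m+1`, and its failure at `(1+t)^(2m+1)` yields failure at `(x+y)^(4m+2)`.

The case `γ = 1/2` is the case `γ = -1/2` applied to `(1-x²)(1-y²) f` (`cubeWeight_half`,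
`rulePlus_eq`), which loses four degrees. Failure at `f = (x+y)^(4m-2)` requires the top part
`((x+y)² - (x-y)²)² / 16` of the factor (`squareL_boundaryPoly_mul_ne`).

In one variable, orthogonality of the explicitly given Jacobi polynomials and the mean of
`P_m^{(α+1,β)}` against the weight with parameters `(α,β)`, which is the Radau weight at `1` up to
normalization, come from alternating binomial sums (`meanL_jacobi_mul_eq_zero`,
`meanL_jacobi_succ`). Gauss quadrature with the Christoffel function as weights follows from the
reproducing kernel (`gauss_quadrature`), and Radau quadrature from Gauss quadrature for
`(1-t) w_{α,β}` (`radau_quadrature`).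

The nodes are counted by orbits: `u + v` and `u v` determine the orbit, and the orbits with `θ = 0`
lie on the diagonal and have two points instead of four.
-/

noncomputable section

namespace XuCubature

/-! ### The normalized Jacobi weight as a functional on polynomials -/

lemma intervalIntegrable_jacobiWeight {a b : ℝ} (ha : -1 < a) (hb : -1 < b) :
    IntervalIntegrable (jacobiWeight a b) volume (-1) 1 := by
  have h1 : IntervalIntegrable (jacobiWeight a b) volume (-1) 0 := by
    have h : IntervalIntegrable (fun t : ℝ => (1 + t) ^ b) volume (-1) 0 := by
      have := (intervalIntegral.intervalIntegrable_rpow' (a := 0) (b := 1) hb).comp_add_left 1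
      simpa using this
    refine h.continuousOn_mul ?_
    refine ContinuousOn.rpow_const (by fun_prop) fun x hx => Or.inl ?_
    rw [Set.uIcc_of_le (by norm_num)] at hx
    have := hx.2
    linarith
  have h2 : IntervalIntegrable (jacobiWeight a b) volume 0 1 := by
    have h : IntervalIntegrable (fun t : ℝ => (1 - t) ^ a) volume 0 1 := by
      have := (intervalIntegral.intervalIntegrable_rpow' (a := 0) (b := 1) ha).comp_sub_left 1
      simpa using this.symm
    refine h.mul_continuousOn ?_
    refine ContinuousOn.rpow_const (by fun_prop) fun x hx => Or.inl ?_
    rw [Set.uIcc_of_le (by norm_num)] at hx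
    have := hx.1
    linarith
  exact h1.trans h2

lemma jacobiWeight_pos {a b t : ℝ} (h1 : -1 < t) (h2 : t < 1) : 0 < jacobiWeight a b t :=
  mul_pos (Real.rpow_pos_of_pos (by linarith) _) (Real.rpow_pos_of_pos (by linarith) _)

lemma intervalIntegrable_mul_jacobiWeight {a b : ℝ} (ha : -1 < a) (hb : -1 < b)
    {f : ℝ → ℝ} (hf : Continuous f) :
    IntervalIntegrable (fun t => f t * jacobiWeight a b t) volume (-1) 1 :=
  (intervalIntegrable_jacobiWeight ha hb).continuousOn_mul hf.continuousOn

/-- The total mass `∫_{-1}^1 (1-t)^a (1+t)^b dt` of the Jacobi weight. -/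
def jacobiMass (a b : ℝ) : ℝ := ∫ t in (-1 : ℝ)..1, jacobiWeight a b t

lemma jacobiMass_pos {a b : ℝ} (ha : -1 < a) (hb : -1 < b) : 0 < jacobiMass a b :=
  intervalIntegral.intervalIntegral_pos_of_pos_on (intervalIntegrable_jacobiWeight ha hb)
    (fun _ ht => jacobiWeight_pos ht.1 ht.2) (by norm_num)

lemma one_sub_mul_jacobiWeight {a b t : ℝ} (ha : -1 < a) (ht : t ≤ 1) :
    (1 - t) * jacobiWeight a b t = jacobiWeight (a + 1) b t := by
  unfold jacobiWeight
  rw [Real.rpow_add_one' (by linarith) (by linarith)]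
  ring

lemma one_add_mul_jacobiWeight {a b t : ℝ} (hb : -1 < b) (ht : -1 ≤ t) :
    (1 + t) * jacobiWeight a b t = jacobiWeight a (b + 1) t := by
  unfold jacobiWeight
  rw [Real.rpow_add_one' (by linarith) (by linarith)]
  ring

lemma integral_one_sub_mul {a b : ℝ} (ha : -1 < a) (f : ℝ → ℝ) :
    ∫ t in (-1 : ℝ)..1, (1 - t) * f t * jacobiWeight a b t =
      ∫ t in (-1 : ℝ)..1, f t * jacobiWeight (a + 1) b t := by
  refine intervalIntegral.integral_congr fun t ht => ?_
  rw [Set.uIcc_of_le (by norm_num)] at ht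
  simp only [← one_sub_mul_jacobiWeight (b := b) ha ht.2]
  ring

lemma integral_one_add_mul {a b : ℝ} (hb : -1 < b) (f : ℝ → ℝ) :
    ∫ t in (-1 : ℝ)..1, (1 + t) * f t * jacobiWeight a b t =
      ∫ t in (-1 : ℝ)..1, f t * jacobiWeight a (b + 1) t := by
  refine intervalIntegral.integral_congr fun t ht => ?_
  rw [Set.uIcc_of_le (by norm_num)] at ht
  simp only [← one_add_mul_jacobiWeight (a := a) hb ht.1]
  ring

lemma jacobiMass_add {a b : ℝ} (ha : -1 < a) (hb : -1 < b) :
    jacobiMass (a + 1) b + jacobiMass a (b + 1) = 2 * jacobiMass a b := by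
  have h1 := integral_one_sub_mul (b := b) ha fun _ => 1
  have h2 := integral_one_add_mul (a := a) hb fun _ => 1
  simp only [one_mul, mul_one] at h1 h2
  unfold jacobiMass
  rw [← h1, ← h2, ← intervalIntegral.integral_add, ← intervalIntegral.integral_const_mul]
  · congr 1
    ext t
    ring
  · exact intervalIntegrable_mul_jacobiWeight ha hb (by fun_prop)
  · exact intervalIntegrable_mul_jacobiWeight ha hb (by fun_prop)

/-- Integration of the derivative of `(1-t)^(a+1) (1+t)^(b+1)`, which vanishes at `±1`. -/
lemma jacobiMass_by_parts {a b : ℝ} (ha : -1 < a) (hb : -1 < b) :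
    (b + 1) * jacobiMass (a + 1) b = (a + 1) * jacobiMass a (b + 1) := by
  have hcont : ContinuousOn (jacobiWeight (a + 1) (b + 1)) (Set.Icc (-1) 1) := by
    unfold jacobiWeight
    refine ContinuousOn.mul ?_ ?_ <;>
      exact ContinuousOn.rpow_const (by fun_prop) fun x hx => Or.inr (by linarith)
  have hder : ∀ t ∈ Set.Ioo (-1 : ℝ) 1, HasDerivAt (jacobiWeight (a + 1) (b + 1))
      ((b + 1) * jacobiWeight (a + 1) b t - (a + 1) * jacobiWeight a (b + 1) t) t := by
    intro t ht
    have h1 : HasDerivAt (fun t : ℝ => (1 - t) ^ (a + 1))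
        (-1 * (a + 1) * (1 - t) ^ (a + 1 - 1)) t :=
      ((hasDerivAt_id t).const_sub 1).rpow_const (Or.inl (by have := ht.2; simp; linarith))
    have h2 : HasDerivAt (fun t : ℝ => (1 + t) ^ (b + 1)) (1 * (b + 1) * (1 + t) ^ (b + 1 - 1)) t :=
      ((hasDerivAt_id t).const_add 1).rpow_const (Or.inl (by have := ht.1; simp; linarith))
    refine (h1.mul h2).congr_deriv ?_
    simp only [jacobiWeight, add_sub_cancel_right]
    ring
  have i1 := intervalIntegrable_jacobiWeight (a := a + 1) (b := b) (by linarith) hb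
  have i2 := intervalIntegrable_jacobiWeight (a := a) (b := b + 1) ha (by linarith)
  have h := intervalIntegral.integral_eq_sub_of_hasDerivAt_of_le (by norm_num) hcont hder
    ((i1.const_mul _).sub (i2.const_mul _))
  rw [intervalIntegral.integral_sub (i1.const_mul _) (i2.const_mul _),
    intervalIntegral.integral_const_mul, intervalIntegral.integral_const_mul] at h
  have e1 : jacobiWeight (a + 1) (b + 1) 1 = 0 := by
    simp [jacobiWeight, Real.zero_rpow (show a + 1 ≠ 0 by linarith)]
  have e2 : jacobiWeight (a + 1) (b + 1) (-1) = 0 := by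
    simp [jacobiWeight, Real.zero_rpow (show b + 1 ≠ 0 by linarith)]
  rw [e1, e2] at h
  unfold jacobiMass
  linarith

lemma jacobiMass_succ_left {a b : ℝ} (ha : -1 < a) (hb : -1 < b) :
    jacobiMass (a + 1) b = 2 * (a + 1) / (a + b + 2) * jacobiMass a b := by
  have h1 := jacobiMass_add ha hb
  have h2 := jacobiMass_by_parts ha hb
  have h3 : a + b + 2 ≠ 0 := by linarith
  field_simp
  linear_combination (a + 1) * h1 + h2

lemma jacobiMass_succ_right {a b : ℝ} (ha : -1 < a) (hb : -1 < b) :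
    jacobiMass a (b + 1) = 2 * (b + 1) / (a + b + 2) * jacobiMass a b := by
  have h1 := jacobiMass_add ha hb
  have h2 := jacobiMass_by_parts ha hb
  have h3 : a + b + 2 ≠ 0 := by linarith
  field_simp
  linear_combination (b + 1) * h1 - h2

section oneVariable

open Polynomial

/-- The integral against the normalized Jacobi weight as a linear functional on polynomials. -/
def meanL {a b : ℝ} (ha : -1 < a) (hb : -1 < b) : ℝ[X] →ₗ[ℝ] ℝ where
  toFun f := jacobiMean a b fun t => f.eval t
  map_add' f g := by
    simp only [jacobiMean, eval_add, add_mul]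
    rw [intervalIntegral.integral_add, add_div]
    · exact intervalIntegrable_mul_jacobiWeight ha hb f.continuous
    · exact intervalIntegrable_mul_jacobiWeight ha hb g.continuous
  map_smul' c f := by
    simp only [jacobiMean, eval_smul, smul_eq_mul, mul_assoc, RingHom.id_apply]
    rw [intervalIntegral.integral_const_mul, mul_div_assoc]

lemma meanL_apply {a b : ℝ} (ha : -1 < a) (hb : -1 < b) (f : ℝ[X]) :
    meanL ha hb f = (∫ t in (-1 : ℝ)..1, f.eval t * jacobiWeight a b t) / jacobiMass a b := rfl

lemma meanL_one {a b : ℝ} (ha : -1 < a) (hb : -1 < b) : meanL ha hb 1 = 1 := by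
  simp only [meanL_apply, eval_one, one_mul]
  exact div_self (jacobiMass_pos ha hb).ne'

lemma meanL_C_mul {a b : ℝ} (ha : -1 < a) (hb : -1 < b) (c : ℝ) (f : ℝ[X]) :
    meanL ha hb (C c * f) = c * meanL ha hb f := by
  rw [← smul_eq_C_mul, map_smul, smul_eq_mul]

lemma meanL_one_sub_mul {a b : ℝ} (ha : -1 < a) (hb : -1 < b) (ha' : -1 < a + 1) (f : ℝ[X]) :
    meanL ha hb ((1 - X) * f) = 2 * (a + 1) / (a + b + 2) * meanL ha' hb f := by
  simp only [meanL_apply, eval_mul, eval_sub, eval_one, eval_X]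
  rw [integral_one_sub_mul ha, jacobiMass_succ_left ha hb]
  have := (jacobiMass_pos ha hb).ne'
  have h1 : a + 1 ≠ 0 := by linarith
  have h2 : a + b + 2 ≠ 0 := by linarith
  field_simp

lemma meanL_one_add_mul {a b : ℝ} (ha : -1 < a) (hb : -1 < b) (hb' : -1 < b + 1) (f : ℝ[X]) :
    meanL ha hb ((1 + X) * f) = 2 * (b + 1) / (a + b + 2) * meanL ha hb' f := by
  simp only [meanL_apply, eval_mul, eval_add, eval_one, eval_X]
  rw [integral_one_add_mul hb, jacobiMass_succ_right ha hb]
  have := (jacobiMass_pos ha hb).ne'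
  have h1 : b + 1 ≠ 0 := by linarith
  have h2 : a + b + 2 ≠ 0 := by linarith
  field_simp

lemma meanL_pos {a b : ℝ} (ha : -1 < a) (hb : -1 < b) {f : ℝ[X]} (hf0 : f ≠ 0)
    (hf : ∀ t ∈ Set.Ioo (-1 : ℝ) 1, 0 ≤ f.eval t) : 0 < meanL ha hb f := by
  rw [meanL_apply]
  refine div_pos ?_ (jacobiMass_pos ha hb)
  have hint := intervalIntegrable_mul_jacobiWeight ha hb f.continuous
  have hae : ∀ᵐ t ∂(volume.restrict (Set.Ioc (-1 : ℝ) 1)), t ∈ Set.Ioo (-1 : ℝ) 1 := by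
    rw [← Measure.restrict_congr_set Ioo_ae_eq_Ioc]
    exact ae_restrict_mem measurableSet_Ioo
  rw [intervalIntegral.integral_of_le (by norm_num),
    integral_pos_iff_support_of_nonneg_ae ?_
      ((intervalIntegrable_iff_integrableOn_Ioc_of_le (by norm_num)).1 hint)]
  · rw [Measure.restrict_apply' measurableSet_Ioc]
    have hsub : Set.Ioo (-1 : ℝ) 1 \ {x | f.IsRoot x} ⊆
        (Function.support fun t => f.eval t * jacobiWeight a b t) ∩ Set.Ioc (-1) 1 := by
      intro t ht
      exact ⟨mul_ne_zero ht.2 (jacobiWeight_pos ht.1.1 ht.1.2).ne', ht.1.1, ht.1.2.le⟩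
    refine lt_of_lt_of_le ?_ (measure_mono hsub)
    rw [measure_sdiff_null (Set.Finite.measure_zero (finite_setOfPred_isRoot hf0) _)]
    simp
  · filter_upwards [hae] with t ht
    exact mul_nonneg (hf t ht) (jacobiWeight_pos ht.1 ht.2).le

/-- The mixed moments of the Jacobi weight. -/
lemma meanL_moment (k l : ℕ) : ∀ {a b : ℝ} (ha : -1 < a) (hb : -1 < b),
    meanL ha hb ((1 - X) ^ k * (1 + X) ^ l) = 2 ^ (k + l) * (ascPochhammer ℝ k).eval (a + 1) *
      (ascPochhammer ℝ l).eval (b + 1) / (ascPochhammer ℝ (k + l)).eval (a + b + 2) := by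
  induction k with
  | zero =>
    induction l with
    | zero => intro a b ha hb; simp [meanL_one]
    | succ l ih =>
      intro a b ha hb
      have hb' : -1 < b + 1 := by linarith
      have := ih ha hb'
      rw [pow_zero, one_mul] at this ⊢
      rw [pow_succ', meanL_one_add_mul ha hb hb', this]
      simp only [zero_add, ascPochhammer_zero, eval_one, ascPochhammer_succ_left, eval_mul,
        eval_X, eval_comp, eval_add, mul_one]
      rw [show a + (b + 1) + 2 = a + b + 2 + 1 by ring]
      have h2 : a + b + 2 ≠ 0 := by linarith
      have h3 := (ascPochhammer_pos l (a + b + 2 + 1) (by linarith)).ne'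
      field_simp
      ring
  | succ k ih =>
    intro a b ha hb
    have ha' : -1 < a + 1 := by linarith
    rw [pow_succ', mul_assoc, meanL_one_sub_mul ha hb ha', ih ha' hb,
      show k + 1 + l = (k + l) + 1 by ring]
    simp only [ascPochhammer_succ_left, eval_mul, eval_X, eval_comp, eval_add, eval_one]
    rw [show a + 1 + b + 2 = a + b + 2 + 1 by ring]
    have h2 : a + b + 2 ≠ 0 := by linarith
    have h3 := (ascPochhammer_pos (k + l) (a + b + 2 + 1) (by linarith)).ne'
    field_simp
    ring

/-! ### Alternating binomial sums -/

lemma alternating_sum_eq_fwdDiff (f : ℝ → ℝ) (n : ℕ) (y : ℝ) :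
    ∑ k ∈ Finset.range (n + 1), (-1 : ℝ) ^ k * n.choose k * f (y + k) =
      (-1) ^ n * (fwdDiff 1)^[n] f y := by
  rw [fwdDiff_iter_eq_sum_shift, Finset.mul_sum]
  refine Finset.sum_congr rfl fun k hk => ?_
  have hk' : k ≤ n := by simpa [Nat.lt_succ_iff] using hk
  simp only [nsmul_eq_mul, mul_one, zsmul_eq_mul]
  push_cast
  rw [← mul_assoc, ← mul_assoc, ← pow_add, show n + (n - k) = k + 2 * (n - k) by omega, pow_add,
    pow_mul]
  simp

lemma alternating_sum_polynomial {R : ℝ[X]} {n : ℕ} (h : R.degree < n) :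
    ∑ k ∈ Finset.range (n + 1), (-1 : ℝ) ^ k * n.choose k * R.eval (k : ℝ) = 0 := by
  by_cases hR : R = 0
  · simp [hR]
  have h1 : R.natDegree < n := (natDegree_lt_iff_degree_lt hR).2 h
  have h2 := alternating_sum_eq_fwdDiff R.eval n 0
  rw [fwdDiff_iter_eq_zero_of_degree_lt h1] at h2
  simpa using h2

lemma ascPochhammer_eval_add (n m : ℕ) (x : ℝ) :
    (ascPochhammer ℝ (n + m)).eval x =
      (ascPochhammer ℝ n).eval x * (ascPochhammer ℝ m).eval (x + n) := by
  rw [← ascPochhammer_mul]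
  simp

lemma ascPochhammer_eval_succ_left (n : ℕ) (x : ℝ) :
    (ascPochhammer ℝ (n + 1)).eval x = x * (ascPochhammer ℝ n).eval (x + 1) := by
  simp [ascPochhammer_succ_left]

lemma fwdDiff_iter_inv (n : ℕ) : ∀ {y : ℝ}, 0 < y →
    (fwdDiff 1)^[n] (fun x : ℝ => x⁻¹) y =
      (-1) ^ n * (n.factorial / (ascPochhammer ℝ (n + 1)).eval y) := by
  induction n with
  | zero => intro y hy; simp
  | succ n ih =>
    intro y hy
    have e1 := ascPochhammer_succ_eval (n + 1) y
    have e2 := ascPochhammer_eval_succ_left (n + 1) y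
    have p1 := (ascPochhammer_pos (n + 1) y hy).ne'
    have p2 := (ascPochhammer_pos (n + 1) (y + 1) (by linarith)).ne'
    have p3 := (ascPochhammer_pos (n + 1 + 1) y hy).ne'
    rw [Function.iterate_succ_apply', fwdDiff, ih (by linarith), ih hy, Nat.factorial_succ,
      pow_succ]
    push_cast at e1 ⊢
    set A := (ascPochhammer ℝ (n + 1)).eval y
    set B := (ascPochhammer ℝ (n + 1)).eval (y + 1)
    set D := (ascPochhammer ℝ (n + 1 + 1)).eval y
    have hA : A = D / (y + (n + 1)) := by
      have : y + ((n : ℝ) + 1) ≠ 0 := by positivity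
      field_simp
      linarith
    have hB : B = D / y := by
      field_simp
      linarith
    rw [hA, hB]
    have : y + ((n : ℝ) + 1) ≠ 0 := by positivity
    field_simp
    ring

lemma alternating_sum_inv (n : ℕ) {c : ℝ} (hc : 0 < c) :
    ∑ k ∈ Finset.range (n + 1), (-1 : ℝ) ^ k * n.choose k * (c + k)⁻¹ =
      n.factorial / (ascPochhammer ℝ (n + 1)).eval c := by
  rw [alternating_sum_eq_fwdDiff (fun x => x⁻¹) n c, fwdDiff_iter_inv n hc, ← mul_assoc,
    ← mul_pow]
  simp

/-- Splitting `R(k) = R(-c) + (c + k) Q(k)` with `deg Q < n` reduces the sum to the one of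
`1 / (c + k)`. -/
lemma alternating_sum_polynomial_div {R : ℝ[X]} {n : ℕ} (h : R.degree ≤ n) {c : ℝ} (hc : 0 < c) :
    ∑ k ∈ Finset.range (n + 1), (-1 : ℝ) ^ k * n.choose k * (R.eval (k : ℝ) * (c + k)⁻¹) =
      R.eval (-c) * (n.factorial / (ascPochhammer ℝ (n + 1)).eval c) := by
  have hdeg : (R /ₘ (X - C (-c))).degree < n := by
    by_cases hR : R = 0
    · simp [hR, bot_lt_iff_ne_bot]
    · have hpos : 0 < (X - C (-c)).degree := by
        rw [degree_X_sub_C]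
        exact zero_lt_one
      exact (degree_divByMonic_lt R _ hR hpos).trans_le h
  have hsplit : ∀ x : ℝ, R.eval x = R.eval (-c) + (c + x) * (R /ₘ (X - C (-c))).eval x := by
    intro x
    have hx := congrArg (eval x) (modByMonic_add_div R (X - C (-c)))
    rw [modByMonic_X_sub_C_eq_C_eval, eval_add, eval_C, eval_mul, eval_sub, eval_X, eval_C] at hx
    linear_combination -hx
  have key : ∀ k ∈ Finset.range (n + 1),
      (-1 : ℝ) ^ k * n.choose k * (R.eval (k : ℝ) * (c + k)⁻¹) =
      R.eval (-c) * ((-1 : ℝ) ^ k * n.choose k * (c + k)⁻¹) +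
        (-1 : ℝ) ^ k * n.choose k * (R /ₘ (X - C (-c))).eval (k : ℝ) := by
    intro k _
    rw [hsplit k, add_mul, mul_right_comm (c + (k : ℝ)), mul_inv_cancel₀ (by positivity)]
    ring
  rw [Finset.sum_congr rfl key, Finset.sum_add_distrib, alternating_sum_polynomial hdeg,
    ← Finset.mul_sum, alternating_sum_inv n hc, add_zero]

/-! ### Degree, value at `1` and orthogonality of the Jacobi polynomials -/

lemma natDegree_jacobi_term_le (c : ℝ) (k : ℕ) :
    (C c * (C (1 / 2) * (X - 1 : ℝ[X])) ^ k).natDegree ≤ k := by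
  have h1 : (C (1 / 2 : ℝ) * (X - 1 : ℝ[X])).natDegree ≤ 1 := by
    refine (natDegree_C_mul_le _ _).trans ?_
    rw [← C_1]
    exact (natDegree_X_sub_C _).le
  refine (natDegree_C_mul_le _ _).trans (natDegree_pow_le.trans ?_)
  nlinarith

lemma natDegree_jacobi_le (a b : ℝ) (n : ℕ) : (jacobi a b n).natDegree ≤ n := by
  refine natDegree_sum_le_of_forall_le _ _ fun k hk => ?_
  exact (natDegree_jacobi_term_le _ k).trans (by simpa [Nat.lt_succ_iff] using hk)

lemma coeff_jacobi_self (a b : ℝ) (n : ℕ) :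
    (jacobi a b n).coeff n =
      (ascPochhammer ℝ n).eval (n + a + b + 1) / n.factorial * (1 / 2) ^ n := by
  have hlow : ∀ k ∈ Finset.range n, (C ((n.choose k : ℝ) *
      (ascPochhammer ℝ k).eval (n + a + b + 1) * (ascPochhammer ℝ (n - k)).eval (a + k + 1) /
      (n.factorial : ℝ)) * (C (1 / 2) * (X - 1 : ℝ[X])) ^ k).coeff n = 0 := by
    intro k hk
    refine coeff_eq_zero_of_natDegree_lt ((natDegree_jacobi_term_le _ k).trans_lt ?_)
    simpa using hk
  rw [jacobi, Finset.sum_range_succ, coeff_add, finsetSum_coeff, Finset.sum_eq_zero hlow,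
    mul_pow, ← C_pow, coeff_C_mul, coeff_C_mul]
  have h1 : ((X - 1 : ℝ[X]) ^ n).coeff n = 1 := by
    have := ((monic_X_sub_C (1 : ℝ)).pow n).coeff_natDegree
    rwa [(monic_X_sub_C (1 : ℝ)).natDegree_pow, natDegree_X_sub_C, mul_one, C_1] at this
  rw [h1]
  simp

lemma coeff_jacobi_self_pos {a b : ℝ} (ha : -1 < a) (hb : -1 < b) (n : ℕ) :
    0 < (jacobi a b n).coeff n := by
  rw [coeff_jacobi_self]
  refine mul_pos (div_pos ?_ (by positivity)) (by positivity)
  rcases Nat.eq_zero_or_pos n with rfl | hn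
  · simp
  · refine ascPochhammer_pos _ _ ?_
    have : (1 : ℝ) ≤ n := by exact_mod_cast hn
    linarith

lemma natDegree_jacobi {a b : ℝ} (ha : -1 < a) (hb : -1 < b) (n : ℕ) :
    (jacobi a b n).natDegree = n :=
  le_antisymm (natDegree_jacobi_le a b n)
    (le_natDegree_of_ne_zero (coeff_jacobi_self_pos ha hb n).ne')

lemma jacobi_ne_zero {a b : ℝ} (ha : -1 < a) (hb : -1 < b) (n : ℕ) : jacobi a b n ≠ 0 := by
  intro h
  have := coeff_jacobi_self_pos ha hb n
  simp [h] at this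

lemma eval_one_jacobi (a b : ℝ) (n : ℕ) :
    (jacobi a b n).eval 1 = (ascPochhammer ℝ n).eval (a + 1) / n.factorial := by
  rw [jacobi, eval_finsetSum, Finset.sum_eq_single 0]
  · simp
  · intro k _ hk
    simp [hk]
  · simp

/-- Termwise integration of a Jacobi polynomial against the weight with parameters `(a', b)`. -/
lemma meanL_jacobi_mul_pow {a a' b : ℝ} (ha' : -1 < a') (hb : -1 < b) (n l : ℕ) :
    meanL ha' hb (jacobi a b n * (1 + X) ^ l) =
      2 ^ l * (ascPochhammer ℝ l).eval (b + 1) / n.factorial *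
      ∑ k ∈ Finset.range (n + 1), (-1 : ℝ) ^ k * n.choose k *
        ((ascPochhammer ℝ k).eval (n + a + b + 1) * (ascPochhammer ℝ (n - k)).eval (a + k + 1) *
          (ascPochhammer ℝ k).eval (a' + 1) / (ascPochhammer ℝ (k + l)).eval (a' + b + 2)) := by
  rw [jacobi, Finset.sum_mul, map_sum, Finset.mul_sum]
  refine Finset.sum_congr rfl fun k _ => ?_
  have h : C (1 / 2 : ℝ) * (X - 1 : ℝ[X]) = C (-1 / 2) * (1 - X) := by
    rw [neg_div, C_neg]
    ring
  rw [h, mul_pow, ← C_pow, mul_assoc (C _) _ ((1 + X) ^ l), mul_assoc (C _) ((1 - X) ^ k),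
    meanL_C_mul, meanL_C_mul, meanL_moment, div_pow,
    pow_add]
  have h2 : (2 : ℝ) ^ k ≠ 0 := by positivity
  field_simp

/-- Up to a factor, the sum over `k` is an `n`-th difference of the polynomial
`(a+b+2+l+k)_{n-1-l}` in `k`, a quotient of two rising factorials. -/
lemma meanL_jacobi_mul_pow_eq_zero {a b : ℝ} (ha : -1 < a) (hb : -1 < b) {n l : ℕ} (h : l < n) :
    meanL ha hb (jacobi a b n * (1 + X) ^ l) = 0 := by
  rw [meanL_jacobi_mul_pow]
  set c := a + b + 2
  have hc : 0 < c := by simp only [c]; linarith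
  set R : ℝ[X] := (ascPochhammer ℝ (n - 1 - l)).comp (X + C (c + l))
  have hR : R.degree < n := by
    refine lt_of_le_of_lt degree_le_natDegree ?_
    rw [natDegree_comp, ascPochhammer_natDegree, natDegree_X_add_C]
    exact_mod_cast (by omega : (n - 1 - l) * 1 < n)
  have hterm : ∀ k ∈ Finset.range (n + 1), (-1 : ℝ) ^ k * n.choose k *
        ((ascPochhammer ℝ k).eval (n + a + b + 1) * (ascPochhammer ℝ (n - k)).eval (a + k + 1) *
          (ascPochhammer ℝ k).eval (a + 1) / (ascPochhammer ℝ (k + l)).eval c) =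
      (ascPochhammer ℝ n).eval (a + 1) / (ascPochhammer ℝ (n - 1)).eval c *
        ((-1 : ℝ) ^ k * n.choose k * R.eval (k : ℝ)) := by
    intro k hk
    have hk' : k ≤ n := by simpa [Nat.lt_succ_iff] using hk
    have e1 := ascPochhammer_eval_add k (n - k) (a + 1)
    rw [show k + (n - k) = n by omega] at e1
    have e2 := ascPochhammer_eval_add (n - 1) k c
    have e3 := ascPochhammer_eval_add (k + l) (n - 1 - l) c
    rw [show k + l + (n - 1 - l) = n - 1 + k by omega, e2] at e3
    have e4 : c + ((n - 1 : ℕ) : ℝ) = n + a + b + 1 := by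
      rw [Nat.cast_sub (by omega)]
      simp only [c]
      push_cast
      ring
    have p1 := (ascPochhammer_pos (n - 1) c hc).ne'
    have p2 := (ascPochhammer_pos (k + l) c hc).ne'
    have e5 : R.eval (k : ℝ) = (ascPochhammer ℝ (n - 1 - l)).eval (c + ((k + l : ℕ) : ℝ)) := by
      simp only [R, eval_comp, eval_add, eval_X, eval_C]
      congr 1
      push_cast
      ring
    rw [e5, e1, show a + 1 + (k : ℝ) = a + k + 1 by ring]
    rw [e4] at e3
    field_simp
    linear_combination (n.choose k : ℝ) * (ascPochhammer ℝ (n - k)).eval (a + k + 1) *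
      (ascPochhammer ℝ k).eval (a + 1) * e3
  rw [Finset.sum_congr rfl hterm, ← Finset.mul_sum, alternating_sum_polynomial hR, mul_zero,
    mul_zero]

/-- Orthogonality of the Jacobi polynomial to all polynomials of lower degree. -/
lemma meanL_jacobi_mul_eq_zero {a b : ℝ} (ha : -1 < a) (hb : -1 < b) {n : ℕ} {f : ℝ[X]}
    (hf : f.degree < n) : meanL ha hb (jacobi a b n * f) = 0 := by
  by_cases hf0 : f = 0
  · simp [hf0]
  have hn : (f.comp (X - 1)).natDegree < n := by
    rw [natDegree_comp, ← C_1, natDegree_X_sub_C, mul_one]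
    exact (natDegree_lt_iff_degree_lt hf0).2 hf
  have h : f = (f.comp (X - 1)).comp (1 + X) := by
    rw [comp_assoc]
    simp
  rw [h, comp, eval₂_eq_sum_range, Finset.mul_sum, map_sum]
  refine Finset.sum_eq_zero fun l hl => ?_
  rw [mul_left_comm, meanL_C_mul, meanL_jacobi_mul_pow_eq_zero ha hb, mul_zero]
  have := Finset.mem_range.1 hl
  omega

/-- The mean of `P_n^{(a+1,b)}` against the weight with parameters `(a,b)`; divided by the value
at `1`, this is the Radau weight at the endpoint. -/
lemma meanL_jacobi_succ {a b : ℝ} (ha : -1 < a) (hb : -1 < b) (n : ℕ) :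
    meanL ha hb (jacobi (a + 1) b n) =
      (ascPochhammer ℝ n).eval (b + 1) / (ascPochhammer ℝ n).eval (a + b + 2) := by
  have h0 := meanL_jacobi_mul_pow (a := a + 1) ha hb n 0
  rw [pow_zero, mul_one] at h0
  rw [h0]
  set c := a + b + 2
  have hc : 0 < c := by simp only [c]; linarith
  set R : ℝ[X] := (ascPochhammer ℝ n).comp (X + C c)
  have hR : R.degree ≤ n := by
    refine degree_le_natDegree.trans ?_
    rw [natDegree_comp, ascPochhammer_natDegree, natDegree_X_add_C, mul_one]
  have hterm : ∀ k ∈ Finset.range (n + 1), (-1 : ℝ) ^ k * n.choose k *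
        ((ascPochhammer ℝ k).eval (n + (a + 1) + b + 1) *
          (ascPochhammer ℝ (n - k)).eval (a + 1 + k + 1) *
          (ascPochhammer ℝ k).eval (a + 1) / (ascPochhammer ℝ (k + 0)).eval c) =
      (ascPochhammer ℝ (n + 1)).eval (a + 1) / (ascPochhammer ℝ n).eval c *
        ((-1 : ℝ) ^ k * n.choose k * (R.eval (k : ℝ) * (a + 1 + k)⁻¹)) := by
    intro k hk
    have hk' : k ≤ n := by simpa [Nat.lt_succ_iff] using hk
    have e1 := ascPochhammer_eval_add k (n - k + 1) (a + 1)
    rw [show k + (n - k + 1) = n + 1 by omega, ascPochhammer_eval_succ_left (n - k)] at e1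
    have e2 := ascPochhammer_eval_add n k c
    have e3 := ascPochhammer_eval_add k n c
    rw [show k + n = n + k by omega, e2] at e3
    have e4 : c + (n : ℝ) = n + (a + 1) + b + 1 := by
      simp only [c]
      ring
    have p1 := (ascPochhammer_pos n c hc).ne'
    have p2 := (ascPochhammer_pos k c hc).ne'
    have p3 : a + 1 + (k : ℝ) ≠ 0 := by
      have : (0 : ℝ) ≤ k := by positivity
      linarith
    have e5 : R.eval (k : ℝ) = (ascPochhammer ℝ n).eval (c + k) := by
      simp only [R, eval_comp, eval_add, eval_X, eval_C]
      congr 1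
      ring
    rw [e5, e1, add_zero]
    rw [e4] at e3
    field_simp
    linear_combination (n.choose k : ℝ) * (ascPochhammer ℝ (n - k)).eval (a + 1 + k + 1) *
      (ascPochhammer ℝ k).eval (a + 1) * e3
  have hRc : R.eval (-(a + 1)) = (ascPochhammer ℝ n).eval (b + 1) := by
    simp only [R, eval_comp, eval_add, eval_X, eval_C]
    congr 1
    simp only [c]
    ring
  rw [Finset.sum_congr rfl hterm, ← Finset.mul_sum,
    alternating_sum_polynomial_div hR (by linarith), hRc]
  have p1 := (ascPochhammer_pos n c hc).ne'
  have p2 := (ascPochhammer_pos (n + 1) (a + 1) (by linarith)).ne'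
  have p3 : (n.factorial : ℝ) ≠ 0 := by positivity
  simp
  field_simp

/-! ### Zeros of the Jacobi polynomials -/

/-- A nonzero polynomial acquires a constant sign on `(-1,1)` after multiplication by a product
of distinct linear factors belonging to some of its zeros there. -/
lemma exists_zeros_const_sign (d : ℕ) : ∀ f : ℝ[X], f ≠ 0 → f.natDegree = d →
    ∃ S : Finset ℝ, (∀ x ∈ S, x ∈ Set.Ioo (-1 : ℝ) 1 ∧ f.IsRoot x) ∧
      ((∀ t ∈ Set.Ioo (-1 : ℝ) 1, 0 ≤ (f * ∏ x ∈ S, (X - C x)).eval t) ∨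
        ∀ t ∈ Set.Ioo (-1 : ℝ) 1, (f * ∏ x ∈ S, (X - C x)).eval t ≤ 0) := by
  induction d with
  | zero =>
    intro f hf hd
    obtain ⟨c, rfl⟩ := natDegree_eq_zero.1 hd
    refine ⟨∅, by simp, ?_⟩
    rcases le_total 0 c with h | h
    · left; intro t _; simpa using h
    · right; intro t _; simpa using h
  | succ d ih =>
    intro f hf hd
    by_cases hroot : ∃ x ∈ Set.Ioo (-1 : ℝ) 1, f.IsRoot x
    · obtain ⟨x, hx, hfx⟩ := hroot
      obtain ⟨g, rfl⟩ := dvd_iff_isRoot.2 hfx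
      have hg : g ≠ 0 := right_ne_zero_of_mul hf
      have hgd : g.natDegree = d := by
        rw [natDegree_mul (X_sub_C_ne_zero x) hg, natDegree_X_sub_C] at hd
        omega
      obtain ⟨S, hS, hsign⟩ := ih g hg hgd
      have hroots : ∀ y ∈ S, y ∈ Set.Ioo (-1 : ℝ) 1 ∧ ((X - C x) * g).IsRoot y := fun y hy =>
        ⟨(hS y hy).1, root_mul_left_of_isRoot _ (hS y hy).2⟩
      by_cases hxS : x ∈ S
      -- the new factor merges with the one in the product, which is dropped
      · refine ⟨S.erase x, fun y hy => hroots y (Finset.mem_of_mem_erase hy), ?_⟩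
        have : (X - C x) * g * ∏ y ∈ S.erase x, (X - C y) = g * ∏ y ∈ S, (X - C y) := by
          rw [← Finset.mul_prod_erase S _ hxS]
          ring
        rwa [this]
      · refine ⟨insert x S, ?_, ?_⟩
        · intro y hy
          rcases Finset.mem_insert.1 hy with rfl | hy
          · exact ⟨hx, hfx⟩
          · exact hroots y hy
        · have : ∀ t, ((X - C x) * g * ∏ y ∈ insert x S, (X - C y)).eval t =
              (t - x) ^ 2 * (g * ∏ y ∈ S, (X - C y)).eval t := by
            intro t
            rw [Finset.prod_insert hxS]
            simp only [eval_mul, eval_sub, eval_X, eval_C]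
            ring
          simp only [this]
          refine hsign.imp (fun h t ht => ?_) (fun h t ht => ?_)
          · exact mul_nonneg (sq_nonneg _) (h t ht)
          · exact mul_nonpos_of_nonneg_of_nonpos (sq_nonneg _) (h t ht)
    · refine ⟨∅, by simp, ?_⟩
      simp only [Finset.prod_empty, mul_one]
      by_contra! hcon
      obtain ⟨⟨s, hs, hfs⟩, t, ht, hft⟩ := hcon
      have hivt := isPreconnected_Ioo.intermediate_value hs ht f.continuous.continuousOn
      obtain ⟨x, hx, hfx⟩ := hivt ⟨hfs.le, hft.le⟩
      exact hroot ⟨x, hx, hfx⟩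

/-- The zeros in `(-1,1)` that give a constant sign must number at least `n`, since the product of
fewer linear factors is orthogonal to `P_n`. -/
lemma exists_jacobi_zeros {a b : ℝ} (ha : -1 < a) (hb : -1 < b) (n : ℕ) :
    ∃ S : Finset ℝ, S.card = n ∧ (∀ x ∈ S, x ∈ Set.Ioo (-1 : ℝ) 1) ∧
      ∀ x, (jacobi a b n).IsRoot x ↔ x ∈ S := by
  have hP := jacobi_ne_zero ha hb n
  obtain ⟨S, hS, hsign⟩ := exists_zeros_const_sign _ _ hP rfl
  have hQ : (∏ x ∈ S, (X - C x)).Monic := monic_prod_of_monic _ _ fun x _ => monic_X_sub_C x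
  have hsub : S ⊆ (jacobi a b n).roots.toFinset := by
    intro x hx
    simpa [hP] using (hS x hx).2
  have hle : (jacobi a b n).roots.toFinset.card ≤ n :=
    (Multiset.toFinset_card_le _).trans ((card_roots' _).trans (natDegree_jacobi_le a b n))
  have hge : n ≤ S.card := by
    by_contra! hlt
    have h0 : meanL ha hb (jacobi a b n * ∏ x ∈ S, (X - C x)) = 0 := by
      refine meanL_jacobi_mul_eq_zero ha hb ?_
      rw [degree_prod_of_monic _ _ fun x _ => monic_X_sub_C x]
      simpa using hlt
    have hne := mul_ne_zero hP hQ.ne_zero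
    rcases hsign with h | h
    · exact (meanL_pos ha hb hne h).ne' h0
    · have := meanL_pos ha hb (neg_ne_zero.2 hne) fun t ht => by
        rw [eval_neg]
        exact neg_nonneg.2 (h t ht)
      rw [map_neg, h0] at this
      simp at this
  have heq : S = (jacobi a b n).roots.toFinset :=
    Finset.eq_of_subset_of_card_le hsub (hle.trans hge)
  refine ⟨S, le_antisymm ?_ hge, fun x hx => (hS x hx).1, fun x => ?_⟩
  · rw [heq]
    exact hle
  · rw [heq]
    simp [hP]

/-! ### Gauss quadrature with the Christoffel function as weights -/

/-- The Jacobi polynomials of degree less than `n` span the polynomials of degree less than `n`. -/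
lemma linearMap_eq_zero_of_jacobi {a b : ℝ} (ha : -1 < a) (hb : -1 < b) (L : ℝ[X] →ₗ[ℝ] ℝ) (n : ℕ)
    (h : ∀ i < n, L (jacobi a b i) = 0) : ∀ r : ℝ[X], r.degree < n → L r = 0 := by
  induction n with
  | zero =>
    intro r hr
    have : r = 0 := by simpa using hr
    simp [this]
  | succ n ih =>
    intro r hr
    have hc := (coeff_jacobi_self_pos ha hb n).ne'
    set s := r - C (r.coeff n / (jacobi a b n).coeff n) * jacobi a b n
    have hs : s.degree < n := by
      rw [degree_lt_iff_coeff_zero]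
      intro k hk
      rcases hk.eq_or_lt with rfl | hk
      · simp only [s, coeff_sub, coeff_C_mul]
        field_simp
        ring
      · have h1 : r.coeff k = 0 := (degree_lt_iff_coeff_zero _ _).1 hr k hk
        have h2 : (jacobi a b n).coeff k = 0 :=
          coeff_eq_zero_of_natDegree_lt ((natDegree_jacobi_le a b n).trans_lt hk)
        simp [s, h1, h2]
    have h1 := ih (fun i hi => h i (by omega)) s hs
    have h2 : r = s + (r.coeff n / (jacobi a b n).coeff n) • jacobi a b n := by
      simp [s, smul_eq_C_mul]
    rw [h2, map_add, h1, map_smul, h n (by omega), smul_zero, add_zero]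

lemma degree_jacobi {a b : ℝ} (ha : -1 < a) (hb : -1 < b) (n : ℕ) : (jacobi a b n).degree = n := by
  rw [degree_eq_natDegree (jacobi_ne_zero ha hb n), natDegree_jacobi ha hb]

lemma meanL_jacobi_mul_jacobi {a b : ℝ} (ha : -1 < a) (hb : -1 < b) {i j : ℕ} (h : i ≠ j) :
    meanL ha hb (jacobi a b i * jacobi a b j) = 0 := by
  rcases h.lt_or_gt with h | h
  · rw [mul_comm]
    refine meanL_jacobi_mul_eq_zero ha hb ?_
    rw [degree_jacobi ha hb]
    exact_mod_cast h
  · refine meanL_jacobi_mul_eq_zero ha hb ?_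
    rw [degree_jacobi ha hb]
    exact_mod_cast h

/-- The reproducing kernel `∑_{i<n} p_i(x) p_i` of the orthonormal Jacobi polynomials, as a
polynomial in its second variable. -/
def jacobiKernel {a b : ℝ} (ha : -1 < a) (hb : -1 < b) (n : ℕ) (x : ℝ) : ℝ[X] :=
  ∑ i ∈ Finset.range n,
    C ((jacobi a b i).eval x / meanL ha hb (jacobi a b i ^ 2)) * jacobi a b i

lemma meanL_jacobi_sq_pos {a b : ℝ} (ha : -1 < a) (hb : -1 < b) (i : ℕ) :
    0 < meanL ha hb (jacobi a b i ^ 2) :=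
  meanL_pos ha hb (pow_ne_zero _ (jacobi_ne_zero ha hb i)) fun t _ => by
    rw [eval_pow]
    exact sq_nonneg _

/-- The reproducing property of the kernel. -/
lemma meanL_jacobiKernel_mul {a b : ℝ} (ha : -1 < a) (hb : -1 < b) (n : ℕ) (x : ℝ) {r : ℝ[X]}
    (hr : r.degree < n) : meanL ha hb (jacobiKernel ha hb n x * r) = r.eval x := by
  have := linearMap_eq_zero_of_jacobi ha hb
    (meanL ha hb ∘ₗ LinearMap.mulLeft ℝ (jacobiKernel ha hb n x) - leval x) n ?_ r hr
  · simpa [sub_eq_zero] using this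
  · intro j hj
    simp only [LinearMap.sub_apply, LinearMap.comp_apply, LinearMap.mulLeft_apply, leval_apply,
      jacobiKernel, Finset.sum_mul, map_sum, mul_assoc, meanL_C_mul]
    rw [Finset.sum_eq_single j]
    · rw [← sq, div_mul_cancel₀ _ (meanL_jacobi_sq_pos ha hb j).ne', sub_self]
    · intro i _ hij
      rw [meanL_jacobi_mul_jacobi ha hb hij, mul_zero]
    · intro h
      exact absurd (Finset.mem_range.2 hj) h

lemma degree_jacobiKernel_lt {a b : ℝ} (ha : -1 < a) (hb : -1 < b) {n : ℕ} (x : ℝ) :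
    (jacobiKernel ha hb n x).degree < n := by
  refine (degree_sum_le _ _).trans_lt ((Finset.sup_lt_iff (by simp [bot_lt_iff_ne_bot])).2 ?_)
  intro i hi
  rw [← smul_eq_C_mul]
  refine (degree_smul_le _ _).trans_lt ?_
  rw [degree_jacobi ha hb]
  exact_mod_cast Finset.mem_range.1 hi

lemma christoffel_eq {a b : ℝ} (ha : -1 < a) (hb : -1 < b) (n : ℕ) (x : ℝ) :
    christoffel a b n x = ((jacobiKernel ha hb n x).eval x)⁻¹ := by
  simp only [christoffel, jacobiKernel, eval_finsetSum, eval_mul, eval_C]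
  congr 1
  refine Finset.sum_congr rfl fun i _ => ?_
  have : jacobiMean a b (fun t => (jacobi a b i).eval t ^ 2) = meanL ha hb (jacobi a b i ^ 2) := by
    simp [meanL]
  rw [this]
  ring

lemma christoffel_pos {a b : ℝ} (ha : -1 < a) (hb : -1 < b) {n : ℕ} (hn : 0 < n) (x : ℝ) :
    0 < christoffel a b n x := by
  rw [christoffel_eq ha hb, inv_pos]
  simp only [jacobiKernel, eval_finsetSum, eval_mul, eval_C]
  refine Finset.sum_pos' (fun i _ => ?_) ⟨0, Finset.mem_range.2 hn, ?_⟩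
  · rw [div_mul_eq_mul_div]
    exact div_nonneg (mul_self_nonneg _) (meanL_jacobi_sq_pos ha hb i).le
  · rw [div_mul_eq_mul_div]
    refine div_pos ?_ (meanL_jacobi_sq_pos ha hb 0)
    simp [jacobi]

/-- Division by `P_n` and Lagrange interpolation give a rule of degree `2n-1` whose weights are the
means of the basis polynomials; applied to the product of a basis polynomial with the reproducing
kernel at the same node, it identifies the weight as the value of the Christoffel function. -/
theorem gauss_quadrature {a b : ℝ} (ha : -1 < a) (hb : -1 < b) {n : ℕ} {S : Finset ℝ}
    (hcard : S.card = n) (hS : ∀ x, (jacobi a b n).IsRoot x ↔ x ∈ S) {f : ℝ[X]}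
    (hf : f.degree < (2 * n : ℕ)) :
    meanL ha hb f = ∑ x ∈ S, christoffel a b n x * f.eval x := by
  set P := jacobi a b n
  have hP : P ≠ 0 := jacobi_ne_zero ha hb n
  have hPd : P.degree = n := degree_jacobi ha hb n
  have hinj : Set.InjOn (id : ℝ → ℝ) S := Set.injOn_id _
  have interp : ∀ f : ℝ[X], f.degree < (2 * n : ℕ) →
      meanL ha hb f = ∑ x ∈ S, meanL ha hb (Lagrange.basis S id x) * f.eval x := by
    intro f hf
    have hq : (f / P).degree < n := by
      by_cases hfP : f.degree < P.degree
      · rw [(Polynomial.div_eq_zero_iff hP).2 hfP]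
        simp [bot_lt_iff_ne_bot]
      · have h := degree_add_div hP (not_lt.1 hfP)
        rw [hPd] at h
        rw [← h] at hf
        by_contra hcon
        rw [not_lt] at hcon
        refine absurd hf (not_lt.2 ?_)
        calc ((2 * n : ℕ) : WithBot ℕ) = n + n := by push_cast; ring
          _ ≤ n + (f / P).degree := by gcongr
    have hr : (f % P).degree < S.card := by
      rw [hcard, ← hPd]
      exact degree_mod_lt f hP
    have hfr : ∀ x ∈ S, (f % P).eval x = f.eval x := by
      intro x hx
      have h0 : P.eval x = 0 := (hS x).2 hx
      conv_rhs => rw [← EuclideanDomain.div_add_mod f P]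
      simp [h0]
    have hLag := Lagrange.eq_interpolate (s := S) (v := id) hinj hr
    calc meanL ha hb f = meanL ha hb (P * (f / P)) + meanL ha hb (f % P) := by
          rw [← map_add, EuclideanDomain.div_add_mod]
      _ = meanL ha hb (f % P) := by rw [meanL_jacobi_mul_eq_zero ha hb hq, zero_add]
      _ = _ := by
          rw [hLag, Lagrange.interpolate_apply, map_sum]
          refine Finset.sum_congr rfl fun x hx => ?_
          rw [meanL_C_mul, id, hfr x hx, mul_comm]
  rw [interp f hf]
  refine Finset.sum_congr rfl fun x hx => ?_
  congr 1
  have hbd : (Lagrange.basis S id x).degree < n := by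
    rw [Lagrange.degree_basis hinj hx, hcard]
    have : 0 < S.card := Finset.card_pos.2 ⟨x, hx⟩
    exact_mod_cast (by omega : n - 1 < n)
  have hk := interp (jacobiKernel ha hb n x * Lagrange.basis S id x) ?_
  · rw [meanL_jacobiKernel_mul ha hb n x hbd, Finset.sum_eq_single x] at hk
    · have h1 : (Lagrange.basis S id x).eval x = 1 := Lagrange.eval_basis_self (v := id) hinj hx
      rw [eval_mul, h1, mul_one] at hk
      rw [christoffel_eq ha hb]
      exact eq_inv_of_mul_eq_one_left hk.symm
    · intro y hy hyx
      have h0 : (Lagrange.basis S id x).eval y = 0 :=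
        Lagrange.eval_basis_of_ne (v := id) hyx.symm hy
      rw [eval_mul, h0, mul_zero, mul_zero]
    · exact fun h => absurd hx h
  · by_cases hK : jacobiKernel ha hb n x = 0
    · rw [hK, zero_mul, degree_zero]
      exact WithBot.bot_lt_coe _
    have hB : Lagrange.basis S id x ≠ 0 := by
      intro h
      rw [h] at hbd
      have := Lagrange.eval_basis_self (v := id) hinj hx
      simp [h] at this
    have h1 := (natDegree_lt_iff_degree_lt hK).2 (degree_jacobiKernel_lt ha hb x)
    have h2 := (natDegree_lt_iff_degree_lt hB).2 hbd
    refine (natDegree_lt_iff_degree_lt (mul_ne_zero hK hB)).1 ?_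
    rw [natDegree_mul hK hB]
    omega

/-! ### Gauss-Radau quadrature -/

/-- A multiple of `P_m^{(a+1,b)}` is subtracted from `f` to make it vanish at `1`; the remainder is
`1 - t` times a polynomial to which the Gauss rule for the parameters `(a+1,b)` applies. -/
theorem radau_quadrature {a b : ℝ} (ha : -1 < a) (hb : -1 < b) {m : ℕ} {S : Finset ℝ}
    (hcard : S.card = m) (hS1 : ∀ x ∈ S, x ∈ Set.Ioo (-1 : ℝ) 1)
    (hS : ∀ x, (jacobi (a + 1) b m).IsRoot x ↔ x ∈ S) {f : ℝ[X]} (hf : f.natDegree ≤ 2 * m) :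
    meanL ha hb f = (ascPochhammer ℝ m).eval (b + 1) /
        ((ascPochhammer ℝ m).eval (a + 2) / (m.factorial : ℝ) *
          (ascPochhammer ℝ m).eval (a + b + 2)) * f.eval 1 +
      ∑ x ∈ S, 2 * (a + 1) / (a + b + 2) * (christoffel (a + 1) b m x / (1 - x)) * f.eval x := by
  have ha' : -1 < a + 1 := by linarith
  set P := jacobi (a + 1) b m
  have hP1 : P.eval 1 = (ascPochhammer ℝ m).eval (a + 2) / m.factorial := by
    rw [eval_one_jacobi, show a + 1 + 1 = a + 2 by ring]
  have hP1pos : 0 < P.eval 1 := by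
    rw [hP1]
    exact div_pos (ascPochhammer_pos _ _ (by linarith)) (by positivity)
  set c := f.eval 1 / P.eval 1
  obtain ⟨h, hh⟩ : (X - C 1) ∣ f - C c * P := by
    rw [dvd_iff_isRoot, IsRoot, eval_sub, eval_mul, eval_C, div_mul_cancel₀ _ hP1pos.ne', sub_self]
  have hf2 : f = C c * P + (1 - X) * (-h) := by
    rw [C_1] at hh
    linear_combination hh
  have hdeg : (-h).degree < (2 * m : ℕ) := by
    by_cases hh0 : h = 0
    · rw [hh0, neg_zero, degree_zero]
      exact WithBot.bot_lt_coe _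
    have h1 : (f - C c * P).natDegree ≤ 2 * m := by
      refine (natDegree_sub_le _ _).trans (max_le hf ?_)
      refine (natDegree_C_mul_le _ _).trans ((natDegree_jacobi_le _ _ _).trans (by omega))
    rw [hh, natDegree_mul (X_sub_C_ne_zero 1) hh0, natDegree_X_sub_C] at h1
    rw [degree_neg]
    exact (natDegree_lt_iff_degree_lt hh0).1 (by omega)
  have hfx : ∀ x ∈ S, f.eval x = (1 - x) * (-h).eval x := by
    intro x hx
    have h0 : P.eval x = 0 := (hS x).2 hx
    conv_lhs => rw [hf2]
    simp [h0]
  conv_lhs => rw [hf2]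
  rw [map_add, meanL_C_mul, meanL_one_sub_mul ha hb ha', gauss_quadrature ha' hb hcard hS hdeg,
    meanL_jacobi_succ ha hb, Finset.mul_sum]
  congr 1
  · simp only [c, hP1]
    field_simp
  · refine Finset.sum_congr rfl fun x hx => ?_
    rw [hfx x hx]
    have : 1 - x ≠ 0 := by
      have := (hS1 x hx).2
      linarith
    field_simp

/-! ### The Radau angles and weights -/

/-- The angles are determined as a set, hence uniquely as an increasing list. -/
lemma isRadauAngles_range {α β : ℝ} {m : ℕ} {θ : Fin (m + 1) → ℝ} (h : IsRadauAngles α β m θ) :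
    Set.range θ = insert 0 (Real.arccos '' {x | (jacobi (α + 1) β m).IsRoot x}) := by
  have h0 : ∀ k, 0 ≤ θ k := fun k => by
    rw [← h.zero]
    exact h.strictMono.monotone (Fin.zero_le k)
  ext t
  constructor
  · rintro ⟨k, rfl⟩
    by_cases hk : k = 0
    · left
      rw [hk, h.zero]
    · right
      exact ⟨Real.cos (θ k), (h.zeros _).2 ⟨k, hk, rfl⟩,
        Real.arccos_cos (h0 k) (h.lt_pi k).le⟩
  · rintro (rfl | ⟨x, hx, rfl⟩)
    · exact ⟨0, h.zero⟩
    · obtain ⟨k, -, rfl⟩ := (h.zeros x).1 hx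
      exact ⟨k, (Real.arccos_cos (h0 k) (h.lt_pi k).le).symm⟩

lemma existsUnique_isRadauAngles {α β : ℝ} (hα : -1 < α) (hβ : -1 < β) (m : ℕ) :
    ∃! θ : Fin (m + 1) → ℝ, IsRadauAngles α β m θ := by
  obtain ⟨S, hcard, hS1, hS⟩ := exists_jacobi_zeros (a := α + 1) (by linarith) hβ m
  have hinj : Set.InjOn Real.arccos S := fun x hx y hy hxy =>
    Real.arccos_injOn ⟨(hS1 x hx).1.le, (hS1 x hx).2.le⟩ ⟨(hS1 y hy).1.le, (hS1 y hy).2.le⟩ hxy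
  have hnot : (0 : ℝ) ∉ S.image Real.arccos := by
    intro h
    obtain ⟨x, hx, hx0⟩ := Finset.mem_image.1 h
    exact absurd (Real.arccos_eq_zero.1 hx0) (not_le.2 (hS1 x hx).2)
  set T : Finset ℝ := insert 0 (S.image Real.arccos)
  have hT : T.card = m + 1 := by
    rw [Finset.card_insert_of_notMem hnot, Finset.card_image_of_injOn hinj, hcard]
  set e := T.orderEmbOfFin hT
  have hrange : ∀ t, t ∈ T ↔ ∃ k, e k = t := by
    intro t
    rw [← Set.mem_range, Finset.range_orderEmbOfFin]
    rfl
  have hnn : ∀ t ∈ T, 0 ≤ t := by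
    intro t ht
    rcases Finset.mem_insert.1 ht with rfl | ht
    · exact le_rfl
    · obtain ⟨x, -, rfl⟩ := Finset.mem_image.1 ht
      exact Real.arccos_nonneg x
  have he0 : e 0 = 0 := by
    obtain ⟨k, hk⟩ := (hrange 0).1 (Finset.mem_insert_self _ _)
    refine le_antisymm ?_ (hnn _ (Finset.orderEmbOfFin_mem _ _ _))
    rw [← hk]
    exact e.monotone (Fin.zero_le k)
  refine ⟨e, ⟨he0, e.strictMono, fun k => ?_, fun x => ?_⟩, fun θ hθ => ?_⟩
  · rcases Finset.mem_insert.1 (Finset.orderEmbOfFin_mem T hT k) with h | h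
    · change T.orderEmbOfFin hT k < _
      rw [h]
      exact Real.pi_pos
    · obtain ⟨x, hx, hxk⟩ := Finset.mem_image.1 h
      change T.orderEmbOfFin hT k < _
      rw [← hxk]
      refine lt_of_le_of_ne (Real.arccos_le_pi x) fun h => ?_
      exact absurd (Real.arccos_eq_pi.1 h) (not_le.2 (hS1 x hx).1)
  · rw [hS]
    constructor
    · intro hx
      obtain ⟨k, hk⟩ := (hrange (Real.arccos x)).1
        (Finset.mem_insert_of_mem (Finset.mem_image_of_mem _ hx))
      refine ⟨k, ?_, ?_⟩
      · rintro rfl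
        rw [he0] at hk
        exact absurd (Real.arccos_eq_zero.1 hk.symm) (not_le.2 (hS1 x hx).2)
      · rw [hk, Real.cos_arccos (hS1 x hx).1.le (hS1 x hx).2.le]
    · rintro ⟨k, hk, rfl⟩
      rcases Finset.mem_insert.1 ((hrange (e k)).2 ⟨k, rfl⟩) with h | h
      · exact absurd (e.injective (h.trans he0.symm)) hk
      · obtain ⟨x, hx, hxk⟩ := Finset.mem_image.1 h
        rwa [← hxk, Real.cos_arccos (hS1 x hx).1.le (hS1 x hx).2.le]
  · rw [← hθ.strictMono.range_inj e.strictMono, isRadauAngles_range hθ,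
      Finset.range_orderEmbOfFin, Finset.coe_insert, Finset.coe_image]
    congr 2
    ext x
    exact hS x

section angles

variable {α β : ℝ} {m : ℕ} {θ : Fin (m + 1) → ℝ}

lemma IsRadauAngles.nonneg (h : IsRadauAngles α β m θ) (k : Fin (m + 1)) : 0 ≤ θ k := by
  rw [← h.zero]
  exact h.strictMono.monotone (Fin.zero_le k)

lemma IsRadauAngles.cos_injective (h : IsRadauAngles α β m θ) :
    Function.Injective fun k => Real.cos (θ k) := fun j k hjk =>
  h.strictMono.injective (Real.injOn_cos ⟨h.nonneg j, (h.lt_pi j).le⟩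
    ⟨h.nonneg k, (h.lt_pi k).le⟩ hjk)

lemma IsRadauAngles.cos_lt_one (h : IsRadauAngles α β m θ) {k : Fin (m + 1)} (hk : k ≠ 0) :
    Real.cos (θ k) < 1 := by
  refine lt_of_le_of_ne (Real.cos_le_one _) fun h1 => hk (h.cos_injective ?_)
  simp [h1, h.zero]

lemma IsRadauAngles.neg_one_lt_cos (h : IsRadauAngles α β m θ) (k : Fin (m + 1)) :
    -1 < Real.cos (θ k) := by
  rw [← Real.cos_pi]
  exact Real.cos_lt_cos_of_nonneg_of_le_pi (h.nonneg k) le_rfl (h.lt_pi k)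

lemma radauWeight_pos (hα : -1 < α) (hβ : -1 < β) (h : IsRadauAngles α β m θ) (k : Fin (m + 1)) :
    0 < radauWeight α β m θ k := by
  unfold radauWeight
  split_ifs with hk
  · have h1 := ascPochhammer_pos m (β + 1) (by linarith)
    have h2 := ascPochhammer_pos m (α + 2) (by linarith)
    have h3 := ascPochhammer_pos m (α + β + 2) (by linarith)
    positivity
  · have hm : 0 < m := by
      rcases Nat.eq_zero_or_pos m with rfl | hm
      · exact absurd (Subsingleton.elim (α := Fin 1) k 0) hk
      · exact hm
    have h1 := christoffel_pos (a := α + 1) (by linarith) hβ hm (Real.cos (θ k))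
    have h2 := h.cos_lt_one hk
    refine mul_pos (div_pos (by linarith) (by linarith)) (div_pos h1 (by linarith))

variable (α β θ) in
/-- The Gauss-Radau quadrature sum as a linear functional on polynomials. -/
def radauL : ℝ[X] →ₗ[ℝ] ℝ := ∑ k, radauWeight α β m θ k • leval (Real.cos (θ k))

lemma radauL_apply (f : ℝ[X]) :
    radauL α β θ f = ∑ k, radauWeight α β m θ k * f.eval (Real.cos (θ k)) := by
  simp [radauL]

/-- Exactness of the Gauss-Radau rule. -/
lemma meanL_eq_radauL (hα : -1 < α) (hβ : -1 < β) (h : IsRadauAngles α β m θ) {f : ℝ[X]}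
    (hf : f.natDegree ≤ 2 * m) : meanL hα hβ f = radauL α β θ f := by
  classical
  set S : Finset ℝ := (Finset.univ.erase 0).image fun k => Real.cos (θ k)
  have hinj := h.cos_injective
  have hcard : S.card = m := by
    rw [Finset.card_image_of_injective _ hinj, Finset.card_erase_of_mem (Finset.mem_univ _)]
    simp
  have hS1 : ∀ x ∈ S, x ∈ Set.Ioo (-1 : ℝ) 1 := by
    intro x hx
    obtain ⟨k, hk, rfl⟩ := Finset.mem_image.1 hx
    exact ⟨h.neg_one_lt_cos k, h.cos_lt_one (Finset.ne_of_mem_erase hk)⟩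
  have hS : ∀ x, (jacobi (α + 1) β m).IsRoot x ↔ x ∈ S := by
    intro x
    rw [h.zeros]
    simp [S, eq_comm]
  rw [radau_quadrature hα hβ hcard hS1 hS hf, radauL_apply, Finset.sum_image hinj.injOn,
    ← Finset.add_sum_erase _ _ (Finset.mem_univ (0 : Fin (m + 1)))]
  congr 1
  · simp [radauWeight, h.zero]
  · refine Finset.sum_congr rfl fun k hk => ?_
    rw [radauWeight, if_neg (Finset.ne_of_mem_erase hk)]

/-- The degree of exactness of the Gauss-Radau rule is not more than `2m`, as shown by the
polynomial `(1 - t) P_m^{(α+1,β)}(t)²` of degree `2m+1`, which vanishes at all nodes. -/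
lemma meanL_ne_radauL (hα : -1 < α) (hβ : -1 < β) (h : IsRadauAngles α β m θ) :
    meanL hα hβ ((1 + X) ^ (2 * m + 1)) ≠ radauL α β θ ((1 + X) ^ (2 * m + 1)) := by
  intro heq
  have hα' : -1 < α + 1 := by linarith
  set P := jacobi (α + 1) β m
  have hP : P ≠ 0 := jacobi_ne_zero hα' hβ m
  have h1X : (1 - X : ℝ[X]) ≠ 0 := by
    intro h0
    have := congrArg (eval 0) h0
    simp at this
  set f : ℝ[X] := (1 - X) * P ^ 2
  have hfd : f.natDegree ≤ 2 * m + 1 := by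
    refine natDegree_mul_le.trans ?_
    have e1 : (1 - X : ℝ[X]).natDegree ≤ 1 := by
      rw [← natDegree_neg, neg_sub, ← C_1]
      exact (natDegree_X_sub_C _).le
    have e2 : (P ^ 2).natDegree ≤ 2 * m :=
      natDegree_pow_le.trans (Nat.mul_le_mul_left 2 (natDegree_jacobi_le _ _ _))
    omega
  have hfpos : 0 < meanL hα hβ f := by
    refine meanL_pos hα hβ (mul_ne_zero h1X (pow_ne_zero 2 hP)) fun t ht => ?_
    simp only [f, eval_mul, eval_sub, eval_one, eval_X, eval_pow]
    exact mul_nonneg (by linarith [ht.2]) (sq_nonneg _)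
  have hf0 : radauL α β θ f = 0 := by
    rw [radauL_apply]
    refine Finset.sum_eq_zero fun k _ => ?_
    by_cases hk : k = 0
    · simp [hk, h.zero, f]
    · have : P.eval (Real.cos (θ k)) = 0 := (h.zeros _).2 ⟨k, hk, rfl⟩
      simp [f, this]
  set c := f.coeff (2 * m + 1)
  have hmon : ((1 + X : ℝ[X]) ^ (2 * m + 1)).Monic := by
    rw [add_comm, ← C_1]
    exact (monic_X_add_C _).pow _
  have hdeg : ((1 + X : ℝ[X]) ^ (2 * m + 1)).natDegree = 2 * m + 1 := by
    rw [add_comm, ← C_1, natDegree_pow, natDegree_X_add_C, mul_one]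
  have hg : (f - c • (1 + X) ^ (2 * m + 1)).natDegree ≤ 2 * m := by
    rw [natDegree_le_iff_coeff_eq_zero]
    intro N hN
    rcases (Nat.succ_le_of_lt hN).eq_or_lt with rfl | hN
    · have := hmon.coeff_natDegree
      rw [hdeg] at this
      rw [coeff_sub, coeff_smul, Nat.succ_eq_add_one, this]
      simp [c]
    · rw [coeff_sub, coeff_smul, coeff_eq_zero_of_natDegree_lt (hfd.trans_lt hN),
        coeff_eq_zero_of_natDegree_lt (hdeg.le.trans_lt hN)]
      simp
  have hex := meanL_eq_radauL hα hβ h hg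
  rw [map_sub, map_sub, map_smul, map_smul, heq, hf0] at hex
  linarith

end angles

end oneVariable

/-! ### The total mass of the weight on the square -/

lemma setLIntegral_periodic_shift {f : ℝ → ENNReal} (hf : f.Periodic (2 * Real.pi)) (c : ℝ) :
    ∫⁻ x in Set.Ioc 0 (2 * Real.pi), f (x + c) = ∫⁻ x in Set.Ioc 0 (2 * Real.pi), f x := by
  have hT : 0 < 2 * Real.pi := by positivity
  have h1 : ∫⁻ x in Set.Ioc 0 (2 * Real.pi), f (x + c) =
      ∫⁻ x in Set.Ioc c (c + 2 * Real.pi), f x := by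
    have himg : (fun x => x + c) '' Set.Ioc 0 (2 * Real.pi) = Set.Ioc c (c + 2 * Real.pi) := by
      simp [add_comm]
    rw [← himg, lintegral_image_eq_lintegral_abs_deriv_mul measurableSet_Ioc
      (fun x _ => ((hasDerivAt_id' x).add_const c).hasDerivWithinAt)
      (add_left_injective c).injOn]
    simp
  have : VAddInvariantMeasure (AddSubgroup.zmultiples (2 * Real.pi)) ℝ volume :=
    ⟨fun c s _ => measure_preimage_add _ _ _⟩
  have h2 := (isAddFundamentalDomain_Ioc hT c).setLIntegral_eq (isAddFundamentalDomain_Ioc hT 0) f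
    hf.map_vadd_zmultiples
  rw [h1, h2, zero_add]

/-- Rotation of a doubly periodic integral: the substitutions `s ↦ s + r` and `r ↦ r - s/2`
are shifts in one variable each, so no Jacobian and no change of region occur. -/
lemma lintegral_periodic_rotate {F : ℝ → ℝ → ENNReal} (hF : Measurable (Function.uncurry F))
    (h1 : ∀ r, Function.Periodic (fun s => F s r) (2 * Real.pi))
    (h2 : ∀ s, Function.Periodic (F s) (2 * Real.pi)) :
    ∫⁻ s in Set.Ioc 0 (2 * Real.pi), ∫⁻ r in Set.Ioc 0 (2 * Real.pi), F s r =
      ∫⁻ s in Set.Ioc 0 (2 * Real.pi), ∫⁻ r in Set.Ioc 0 (2 * Real.pi),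
        F (r + s / 2) (r - s / 2) := by
  rw [lintegral_lintegral_swap hF.aemeasurable]
  have e1 : ∀ r, ∫⁻ s in Set.Ioc 0 (2 * Real.pi), F s r =
      ∫⁻ s in Set.Ioc 0 (2 * Real.pi), F (s + r) r := fun r =>
    (setLIntegral_periodic_shift (h1 r) r).symm
  simp_rw [e1]
  rw [lintegral_lintegral_swap]
  · refine lintegral_congr fun s => ?_
    have hper : Function.Periodic (fun r => F (s + r) r) (2 * Real.pi) := by
      intro r
      change F (s + (r + 2 * Real.pi)) (r + 2 * Real.pi) = F (s + r) r
      rw [h2 (s + (r + 2 * Real.pi)) r, ← add_assoc]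
      exact h1 r (s + r)
    rw [← setLIntegral_periodic_shift hper (-(s / 2))]
    refine lintegral_congr fun r => ?_
    congr 1
    ring
  · exact (hF.comp (show Measurable fun x : ℝ × ℝ => (x.2 + x.1, x.1) by fun_prop)).aemeasurable

lemma setLIntegral_cos_double (g : ℝ → ENNReal) :
    ∫⁻ s in Set.Ioc 0 (2 * Real.pi), g (Real.cos s) =
      2 * ∫⁻ s in Set.Ioc 0 Real.pi, g (Real.cos s) := by
  have hpi := Real.pi_pos
  have hun : Set.Ioc 0 (2 * Real.pi) = Set.Ioc 0 Real.pi ∪ Set.Ioc Real.pi (2 * Real.pi) :=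
    (Set.Ioc_union_Ioc_eq_Ioc hpi.le (by linarith)).symm
  have himg : (fun s => 2 * Real.pi - s) '' Set.Ico 0 Real.pi =
      Set.Ioc Real.pi (2 * Real.pi) := by
    rw [Set.image_const_sub_Ico]
    congr 1 <;> ring
  rw [hun, lintegral_union measurableSet_Ioc (Set.Ioc_disjoint_Ioc_of_le le_rfl), ← himg,
    lintegral_image_eq_lintegral_abs_deriv_mul measurableSet_Ico
      (fun x _ => ((hasDerivAt_id' x).const_sub (2 * Real.pi)).hasDerivWithinAt)
      (sub_right_injective).injOn, two_mul (∫⁻ _ in _, _)]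
  congr 1
  simp only [abs_neg, abs_one, ENNReal.ofReal_one, one_mul, Real.cos_two_pi_sub]
  exact setLIntegral_congr Ico_ae_eq_Ioc

lemma setLIntegral_cos_two_mul (g : ℝ → ENNReal) :
    ∫⁻ s in Set.Ioc 0 (2 * Real.pi), g (Real.cos (2 * s)) =
      ∫⁻ s in Set.Ioc 0 (2 * Real.pi), g (Real.cos s) := by
  have hpi := Real.pi_pos
  have hun : Set.Ioc 0 (2 * (2 * Real.pi)) =
      Set.Ioc 0 (2 * Real.pi) ∪ Set.Ioc (2 * Real.pi) (2 * (2 * Real.pi)) :=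
    (Set.Ioc_union_Ioc_eq_Ioc (by linarith) (by linarith)).symm
  have himg : (fun s => 2 * s) '' Set.Ioc 0 (2 * Real.pi) = Set.Ioc 0 (2 * (2 * Real.pi)) := by
    rw [Set.image_mul_left_Ioc (by norm_num), mul_zero]
  have himg2 : (fun s => s + 2 * Real.pi) '' Set.Ioc 0 (2 * Real.pi) =
      Set.Ioc (2 * Real.pi) (2 * (2 * Real.pi)) := by
    rw [Set.image_add_const_Ioc, zero_add, ← two_mul]
  have e1 : ∫⁻ s in Set.Ioc 0 (2 * (2 * Real.pi)), g (Real.cos s) =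
      2 * ∫⁻ s in Set.Ioc 0 (2 * Real.pi), g (Real.cos (2 * s)) := by
    rw [← himg, lintegral_image_eq_lintegral_abs_deriv_mul measurableSet_Ioc
      (fun x _ => ((hasDerivAt_id' x).const_mul 2).hasDerivWithinAt)
      (mul_right_injective₀ two_ne_zero).injOn, ← lintegral_const_mul' _ _ (by simp)]
    simp
  have e2 : ∫⁻ s in Set.Ioc 0 (2 * (2 * Real.pi)), g (Real.cos s) =
      2 * ∫⁻ s in Set.Ioc 0 (2 * Real.pi), g (Real.cos s) := by
    rw [hun, lintegral_union measurableSet_Ioc (Set.Ioc_disjoint_Ioc_of_le le_rfl), ← himg2,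
      lintegral_image_eq_lintegral_abs_deriv_mul measurableSet_Ioc
        (fun x _ => ((hasDerivAt_id' x).add_const (2 * Real.pi)).hasDerivWithinAt)
        (add_left_injective _).injOn, two_mul (∫⁻ _ in _, _)]
    simp
  exact (ENNReal.mul_right_inj (by simp) (by simp)).1 (e1.symm.trans e2)

/-- The substitution `x = cos s`. -/
lemma setLIntegral_cos (g : ℝ → ENNReal) :
    ∫⁻ s in Set.Ioc 0 Real.pi, g (Real.cos s) =
      ∫⁻ x in Set.Icc (-1 : ℝ) 1, ENNReal.ofReal ((1 - x ^ 2) ^ (-(1 / 2) : ℝ)) * g x := by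
  have himg : Real.cos '' Set.Ioo 0 Real.pi = Set.Ioo (-1) 1 := by
    ext x
    constructor
    · rintro ⟨s, hs, rfl⟩
      constructor
      · rw [← Real.cos_pi]
        exact Real.cos_lt_cos_of_nonneg_of_le_pi hs.1.le le_rfl hs.2
      · rw [← Real.cos_zero]
        exact Real.cos_lt_cos_of_nonneg_of_le_pi le_rfl hs.2.le hs.1
    · intro hx
      refine ⟨Real.arccos x, ⟨Real.arccos_pos.2 hx.2, ?_⟩, Real.cos_arccos hx.1.le hx.2.le⟩
      refine lt_of_le_of_ne (Real.arccos_le_pi x) fun h => ?_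
      exact absurd (Real.arccos_eq_pi.1 h) (not_le.2 hx.1)
  rw [← setLIntegral_congr (Ioo_ae_eq_Icc (α := ℝ) (μ := volume)), ← himg,
    lintegral_image_eq_lintegral_abs_deriv_mul measurableSet_Ioo
      (fun x _ => (Real.hasDerivAt_cos x).hasDerivWithinAt)
      (Real.injOn_cos.mono Set.Ioo_subset_Icc_self),
    ← setLIntegral_congr (Ioo_ae_eq_Ioc (α := ℝ) (μ := volume))]
  refine setLIntegral_congr_fun measurableSet_Ioo fun s hs => ?_
  have hsin := Real.sin_pos_of_mem_Ioo hs
  have : |(-Real.sin s)| * (1 - Real.cos s ^ 2) ^ (-(1 / 2) : ℝ) = 1 := by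
    rw [abs_neg, abs_of_pos hsin, ← Real.sin_sq, Real.rpow_neg (sq_nonneg _), ← Real.sqrt_eq_rpow,
      Real.sqrt_sq hsin.le, mul_inv_cancel₀ hsin.ne']
  rw [← mul_assoc, ← ENNReal.ofReal_mul (abs_nonneg _), this, ENNReal.ofReal_one, one_mul]

lemma setLIntegral_jacobiWeight {a b : ℝ} (ha : -1 < a) (hb : -1 < b) :
    ∫⁻ t in Set.Icc (-1 : ℝ) 1, ENNReal.ofReal (jacobiWeight a b t) =
      ENNReal.ofReal (jacobiMass a b) := by
  rw [jacobiMass, intervalIntegral.integral_of_le (by norm_num),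
    ofReal_integral_eq_lintegral_ofReal]
  · exact setLIntegral_congr Ioc_ae_eq_Icc.symm
  · exact (intervalIntegrable_iff_integrableOn_Ioc_of_le (by norm_num)).1
      (intervalIntegrable_jacobiWeight ha hb)
  · filter_upwards [ae_restrict_mem measurableSet_Ioc] with t ht
    exact mul_nonneg (Real.rpow_nonneg (by linarith [ht.2]) _)
      (Real.rpow_nonneg (by linarith [ht.1]) _)

/-- `|sin(s/2)|^(2α+1) |cos(s/2)|^(2β+1)` in terms of `u = cos s`. -/
def halfAngleWeight (α β : ℝ) (u : ℝ) : ENNReal :=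
  ENNReal.ofReal (((1 - u) / 2) ^ (α + 1 / 2) * ((1 + u) / 2) ^ (β + 1 / 2))

lemma halfAngleWeight_cos_two_mul (α β s : ℝ) : halfAngleWeight α β (Real.cos (2 * s)) =
    ENNReal.ofReal (|Real.sin s| ^ (2 * α + 1) * |Real.cos s| ^ (2 * β + 1)) := by
  have h1 : (1 - Real.cos (2 * s)) / 2 = |Real.sin s| ^ (2 : ℝ) := by
    rw [Real.rpow_two, sq_abs, Real.cos_two_mul, Real.sin_sq]
    ring
  have h2 : (1 + Real.cos (2 * s)) / 2 = |Real.cos s| ^ (2 : ℝ) := by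
    rw [Real.rpow_two, sq_abs, Real.cos_two_mul]
    ring
  rw [halfAngleWeight, h1, h2, ← Real.rpow_mul (abs_nonneg _), ← Real.rpow_mul (abs_nonneg _)]
  congr 3 <;> ring_nf

lemma setLIntegral_halfAngleWeight {α β : ℝ} (hα : -1 < α) (hβ : -1 < β) :
    ∫⁻ s in Set.Ioc 0 (2 * Real.pi), halfAngleWeight α β (Real.cos s) =
      ENNReal.ofReal (2 * 2 ^ (-(α + β + 1)) * jacobiMass α β) := by
  rw [setLIntegral_cos_double, setLIntegral_cos, ENNReal.ofReal_mul (by positivity),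
    ← setLIntegral_jacobiWeight hα hβ, ENNReal.ofReal_mul (by norm_num), ENNReal.ofReal_ofNat,
    mul_assoc, ← lintegral_const_mul' (ENNReal.ofReal _) _ (by simp)]
  congr 1
  rw [← setLIntegral_congr (Ioo_ae_eq_Icc (α := ℝ) (μ := volume)),
    ← setLIntegral_congr (Ioo_ae_eq_Icc (α := ℝ) (μ := volume))]
  refine setLIntegral_congr_fun measurableSet_Ioo fun t ht => ?_
  have h1 : 0 < 1 - t := by linarith [ht.2]
  have h2 : 0 < 1 + t := by linarith [ht.1]
  have h12 : 1 - t ^ 2 = (1 - t) * (1 + t) := by ring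
  simp only [halfAngleWeight, jacobiWeight]
  rw [h12, ← ENNReal.ofReal_mul (by positivity), ← ENNReal.ofReal_mul (by positivity)]
  congr 1
  have h3 : (2 : ℝ) ^ (-(α + β + 1)) = (2 ^ (α + 1 / 2))⁻¹ * (2 ^ (β + 1 / 2))⁻¹ := by
    rw [← Real.rpow_neg (by norm_num), ← Real.rpow_neg (by norm_num),
      ← Real.rpow_add (by norm_num)]
    congr 1
    ring
  have e1 : (1 - t) ^ α = (1 - t) ^ (-(1 / 2) : ℝ) * (1 - t) ^ (α + 1 / 2) := by
    rw [← Real.rpow_add h1]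
    congr 1
    ring
  have e2 : (1 + t) ^ β = (1 + t) ^ (-(1 / 2) : ℝ) * (1 + t) ^ (β + 1 / 2) := by
    rw [← Real.rpow_add h2]
    congr 1
    ring
  rw [e1, e2, h3, Real.mul_rpow h1.le h2.le, Real.div_rpow h1.le (by norm_num),
    Real.div_rpow h2.le (by norm_num)]
  ring

lemma measurable_cubeWeight (α β γ : ℝ) : Measurable (cubeWeight α β γ) := by
  unfold cubeWeight
  fun_prop

/-- The factor `|x-y|^(2α+1) |x+y|^(2β+1)` of the weight on the square. -/
def diagonalWeight (α β x y : ℝ) : ENNReal :=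
  ENNReal.ofReal (|x - y| ^ (2 * α + 1) * |x + y| ^ (2 * β + 1))

lemma measurable_diagonalWeight_cos (α β : ℝ) : Measurable
    (Function.uncurry fun s r => diagonalWeight α β (Real.cos s) (Real.cos r)) := by
  simp only [diagonalWeight, Function.uncurry_def]
  fun_prop

lemma lintegral_cubeWeight_eq_cos (α β : ℝ) :
    ∫⁻ p in square, ENNReal.ofReal (cubeWeight α β (-(1 / 2)) p) =
      ∫⁻ s in Set.Ioc 0 Real.pi, ∫⁻ r in Set.Ioc 0 Real.pi,
        diagonalWeight α β (Real.cos s) (Real.cos r) := by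
  rw [square, Measure.volume_eq_prod,
    setLIntegral_prod _ (measurable_cubeWeight _ _ _).ennreal_ofReal.aemeasurable]
  simp_rw [setLIntegral_cos]
  rw [setLIntegral_cos fun x => ∫⁻ y in Set.Icc (-1 : ℝ) 1,
    ENNReal.ofReal ((1 - y ^ 2) ^ (-(1 / 2) : ℝ)) * diagonalWeight α β x y]
  refine setLIntegral_congr_fun measurableSet_Icc fun x hx => ?_
  rw [← lintegral_const_mul' _ _ (by simp)]
  refine setLIntegral_congr_fun measurableSet_Icc fun y hy => ?_
  simp only [diagonalWeight]
  have hx0 : 0 ≤ 1 - x ^ 2 := by nlinarith [hx.1, hx.2]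
  have hy0 : 0 ≤ 1 - y ^ 2 := by nlinarith [hy.1, hy.2]
  rw [← ENNReal.ofReal_mul (by positivity), ← ENNReal.ofReal_mul (by positivity)]
  congr 1
  simp only [cubeWeight]
  ring

lemma lintegral_diagonalWeight_double (α β : ℝ) :
    ∫⁻ s in Set.Ioc 0 (2 * Real.pi), ∫⁻ r in Set.Ioc 0 (2 * Real.pi),
        diagonalWeight α β (Real.cos s) (Real.cos r) =
      4 * ∫⁻ s in Set.Ioc 0 Real.pi, ∫⁻ r in Set.Ioc 0 Real.pi,
        diagonalWeight α β (Real.cos s) (Real.cos r) := by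
  have h : ∀ s, ∫⁻ r in Set.Ioc 0 (2 * Real.pi), diagonalWeight α β (Real.cos s) (Real.cos r) =
      2 * ∫⁻ r in Set.Ioc 0 Real.pi, diagonalWeight α β (Real.cos s) (Real.cos r) := fun s =>
    setLIntegral_cos_double (diagonalWeight α β (Real.cos s))
  simp_rw [h]
  rw [lintegral_const_mul' _ _ (by simp),
    setLIntegral_cos_double fun x => ∫⁻ r in Set.Ioc 0 Real.pi,
      diagonalWeight α β x (Real.cos r), ← mul_assoc]
  norm_num

lemma diagonalWeight_rotate (α β s r : ℝ) :
    diagonalWeight α β (Real.cos (r + s / 2)) (Real.cos (r - s / 2)) =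
      (ENNReal.ofReal (2 ^ (2 * (α + β + 1))) * halfAngleWeight α β (Real.cos s)) *
        halfAngleWeight α β (Real.cos (2 * r)) := by
  have hs := halfAngleWeight_cos_two_mul α β (s / 2)
  rw [mul_div_cancel₀ s (two_ne_zero)] at hs
  rw [hs, halfAngleWeight_cos_two_mul, ← ENNReal.ofReal_mul (by positivity),
    ← ENNReal.ofReal_mul (by positivity), diagonalWeight]
  congr 1
  have h1 : Real.cos (r + s / 2) - Real.cos (r - s / 2) =
      -(2 * (Real.sin r * Real.sin (s / 2))) := by
    rw [Real.cos_add, Real.cos_sub]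
    ring
  have h2 : Real.cos (r + s / 2) + Real.cos (r - s / 2) =
      2 * (Real.cos r * Real.cos (s / 2)) := by
    rw [Real.cos_add, Real.cos_sub]
    ring
  have h3 : (2 : ℝ) ^ (2 * (α + β + 1)) = 2 ^ (2 * α + 1) * 2 ^ (2 * β + 1) := by
    rw [← Real.rpow_add (by norm_num)]
    congr 1
    ring
  rw [h1, h2, h3, abs_neg, abs_mul, abs_mul, abs_mul, abs_mul, abs_two,
    Real.mul_rpow (by norm_num) (by positivity), Real.mul_rpow (by positivity) (by positivity),
    Real.mul_rpow (by norm_num) (by positivity), Real.mul_rpow (by positivity) (by positivity)]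
  ring

/-- In the coordinates `x = cos s`, `y = cos r`, a rotation by `45°` factors the weight into
functions of one variable. -/
lemma lintegral_diagonalWeight {α β : ℝ} (hα : -1 < α) (hβ : -1 < β) :
    ∫⁻ s in Set.Ioc 0 (2 * Real.pi), ∫⁻ r in Set.Ioc 0 (2 * Real.pi),
        diagonalWeight α β (Real.cos s) (Real.cos r) =
      ENNReal.ofReal (4 * jacobiMass α β ^ 2) := by
  rw [lintegral_periodic_rotate (measurable_diagonalWeight_cos α β)
    (fun r s => by simp [Real.cos_add_two_pi]) (fun s r => by simp [Real.cos_add_two_pi])]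
  simp_rw [diagonalWeight_rotate]
  have hm : Measurable (halfAngleWeight α β) := by
    unfold halfAngleWeight
    fun_prop
  have hm2 : Measurable fun r => halfAngleWeight α β (Real.cos (2 * r)) :=
    hm.comp (by fun_prop)
  have hm1 : Measurable fun r => halfAngleWeight α β (Real.cos r) := hm.comp (by fun_prop)
  simp_rw [lintegral_const_mul _ hm2, setLIntegral_cos_two_mul,
    setLIntegral_halfAngleWeight hα hβ]
  rw [lintegral_mul_const _ (hm1.const_mul _), lintegral_const_mul _ hm1,
    setLIntegral_halfAngleWeight hα hβ]
  have hM := (jacobiMass_pos hα hβ).le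
  rw [← ENNReal.ofReal_mul (by positivity), ← ENNReal.ofReal_mul (by positivity)]
  congr 1
  have h2 : (2 : ℝ) ^ (2 * (α + β + 1)) * (2 ^ (-(α + β + 1)) * 2 ^ (-(α + β + 1))) = 1 := by
    rw [← Real.rpow_add (by norm_num), ← Real.rpow_add (by norm_num),
      show 2 * (α + β + 1) + (-(α + β + 1) + -(α + β + 1)) = 0 by ring, Real.rpow_zero]
  linear_combination 4 * jacobiMass α β ^ 2 * h2

lemma lintegral_cubeWeight {α β : ℝ} (hα : -1 < α) (hβ : -1 < β) :
    ∫⁻ p in square, ENNReal.ofReal (cubeWeight α β (-(1 / 2)) p) =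
      ENNReal.ofReal (jacobiMass α β ^ 2) := by
  have h := lintegral_diagonalWeight hα hβ
  rw [lintegral_diagonalWeight_double, ENNReal.ofReal_mul (by norm_num), ENNReal.ofReal_ofNat,
    ENNReal.mul_right_inj (by simp) (by simp)] at h
  rw [lintegral_cubeWeight_eq_cos, h]

lemma cubeWeight_nonneg {p : ℝ × ℝ} (hp : p ∈ square) (α β γ : ℝ) : 0 ≤ cubeWeight α β γ p := by
  have hx : 0 ≤ 1 - p.1 ^ 2 := by nlinarith [hp.1.1, hp.1.2]
  have hy : 0 ≤ 1 - p.2 ^ 2 := by nlinarith [hp.2.1, hp.2.2]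
  unfold cubeWeight
  positivity

lemma measurableSet_square : MeasurableSet square := measurableSet_Icc.prod measurableSet_Icc

lemma integrableOn_cubeWeight {α β : ℝ} (hα : -1 < α) (hβ : -1 < β) :
    IntegrableOn (cubeWeight α β (-(1 / 2))) square := by
  refine ⟨(measurable_cubeWeight _ _ _).aestronglyMeasurable, ?_⟩
  rw [hasFiniteIntegral_iff_ofReal, lintegral_cubeWeight hα hβ]
  · exact ENNReal.ofReal_lt_top
  · filter_upwards [ae_restrict_mem measurableSet_square] with p hp
    exact cubeWeight_nonneg hp _ _ _

lemma integral_cubeWeight {α β : ℝ} (hα : -1 < α) (hβ : -1 < β) :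
    ∫ p in square, cubeWeight α β (-(1 / 2)) p = jacobiMass α β ^ 2 := by
  rw [integral_eq_lintegral_of_nonneg_ae, lintegral_cubeWeight hα hβ,
    ENNReal.toReal_ofReal (sq_nonneg _)]
  · filter_upwards [ae_restrict_mem measurableSet_square] with p hp
    exact cubeWeight_nonneg hp _ _ _
  · exact (measurable_cubeWeight _ _ _).aestronglyMeasurable

/-! ### Moments of the weight on the square in the coordinates `x + y`, `x - y` -/

lemma rpow_mul_pow {c y : ℝ} (hc : 0 ≤ c) (hy : -1 < y) (n : ℕ) : c ^ y * c ^ n = c ^ (y + n) := by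
  rcases Nat.eq_zero_or_pos n with rfl | hn
  · simp
  · have : (1 : ℝ) ≤ n := by exact_mod_cast hn
    rw [Real.rpow_add_natCast' hc (by linarith)]

/-- This holds on the diagonals as well: `0 ^ y * 0 ^ n = 0 ^ (y + n)` for `y > -1`, since then
`y + n > 0` unless `n = 0`. -/
lemma pow_mul_cubeWeight {α β : ℝ} (hα : -1 < α) (hβ : -1 < β) (γ : ℝ) (i j : ℕ) (p : ℝ × ℝ) :
    (p.1 + p.2) ^ (2 * i) * (p.1 - p.2) ^ (2 * j) * cubeWeight α β γ p =
      cubeWeight (α + j) (β + i) γ p := by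
  have h1 : |p.1 - p.2| ^ (2 * (α + j) + 1) =
      |p.1 - p.2| ^ (2 * α + 1) * (p.1 - p.2) ^ (2 * j) := by
    rw [← Even.pow_abs (even_two_mul j) (p.1 - p.2), rpow_mul_pow (abs_nonneg _) (by linarith)]
    congr 1
    push_cast
    ring
  have h2 : |p.1 + p.2| ^ (2 * (β + i) + 1) =
      |p.1 + p.2| ^ (2 * β + 1) * (p.1 + p.2) ^ (2 * i) := by
    rw [← Even.pow_abs (even_two_mul i) (p.1 + p.2), rpow_mul_pow (abs_nonneg _) (by linarith)]
    congr 1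
    push_cast
    ring
  rw [cubeWeight, cubeWeight, h1, h2]
  ring

lemma setIntegral_square_swap (f : ℝ × ℝ → ℝ) :
    ∫ p in square, f p.swap = ∫ p in square, f p := by
  have h := (Measure.measurePreserving_swap (μ := (volume : Measure ℝ))
    (ν := (volume : Measure ℝ))).setIntegral_preimage_emb
    MeasurableEquiv.prodComm.measurableEmbedding f square
  have hs : Prod.swap ⁻¹' square = square := by
    ext p
    simp only [square, Set.mem_preimage, Set.mem_prod, Prod.fst_swap, Prod.snd_swap]
    exact and_comm
  rw [hs] at h
  exact h

lemma setIntegral_square_neg (f : ℝ × ℝ → ℝ) :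
    ∫ p in square, f (-p) = ∫ p in square, f p := by
  have h := (Measure.measurePreserving_neg (volume : Measure (ℝ × ℝ))).setIntegral_preimage_emb
    (MeasurableEquiv.neg (ℝ × ℝ)).measurableEmbedding f square
  have hs : Neg.neg ⁻¹' square = square := by
    ext p
    simp only [square, Set.mem_preimage, Set.mem_prod, Prod.fst_neg, Prod.snd_neg, Set.mem_Icc]
    constructor <;> rintro ⟨⟨h1, h2⟩, h3, h4⟩ <;> refine ⟨⟨?_, ?_⟩, ?_, ?_⟩ <;> linarith
  rw [hs] at h
  exact h

lemma cubeWeight_swap (α β γ : ℝ) (p : ℝ × ℝ) : cubeWeight α β γ p.swap = cubeWeight α β γ p := by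
  simp only [cubeWeight, Prod.fst_swap, Prod.snd_swap, abs_sub_comm p.2 p.1, add_comm p.2 p.1]
  ring

lemma cubeWeight_neg (α β γ : ℝ) (p : ℝ × ℝ) : cubeWeight α β γ (-p) = cubeWeight α β γ p := by
  simp only [cubeWeight, Prod.fst_neg, Prod.snd_neg, neg_sq]
  rw [show -p.1 - -p.2 = -(p.1 - p.2) by ring, show -p.1 + -p.2 = -(p.1 + p.2) by ring, abs_neg,
    abs_neg]

open MvPolynomial in
/-- The polynomial `(x+y)^i (x-y)^j`. -/
def diagMonomial (i j : ℕ) : MvPolynomial (Fin 2) ℝ := (X 0 + X 1) ^ i * (X 0 - X 1) ^ j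

lemma evalPoly_diagMonomial (i j : ℕ) (p : ℝ × ℝ) :
    evalPoly (diagMonomial i j) p = (p.1 + p.2) ^ i * (p.1 - p.2) ^ j := by
  simp [evalPoly, diagMonomial]

lemma continuous_evalPoly (f : MvPolynomial (Fin 2) ℝ) : Continuous (evalPoly f) := by
  unfold evalPoly
  exact (MvPolynomial.continuous_eval f).comp (by fun_prop)

lemma integrableOn_evalPoly_mul {α β : ℝ} (hα : -1 < α) (hβ : -1 < β)
    (f : MvPolynomial (Fin 2) ℝ) :
    IntegrableOn (fun p => evalPoly f p * cubeWeight α β (-(1 / 2)) p) square :=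
  (integrableOn_cubeWeight hα hβ).continuousOn_mul (continuous_evalPoly f).continuousOn
    (isCompact_Icc.prod isCompact_Icc)

/-- The integral against the normalized weight with `γ = -1/2`, as a linear functional. -/
def squareL {α β : ℝ} (hα : -1 < α) (hβ : -1 < β) : MvPolynomial (Fin 2) ℝ →ₗ[ℝ] ℝ where
  toFun f := (∫ p in square, evalPoly f p * cubeWeight α β (-(1 / 2)) p) / jacobiMass α β ^ 2
  map_add' f g := by
    rw [← add_div, ← integral_add (integrableOn_evalPoly_mul hα hβ f)
      (integrableOn_evalPoly_mul hα hβ g)]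
    simp only [evalPoly, map_add, add_mul]
  map_smul' c f := by
    simp only [evalPoly, MvPolynomial.smul_eval, mul_assoc, RingHom.id_apply, smul_eq_mul]
    rw [integral_const_mul, mul_div_assoc]

lemma squareL_apply {α β : ℝ} (hα : -1 < α) (hβ : -1 < β) (f : MvPolynomial (Fin 2) ℝ) :
    squareL hα hβ f =
      (∫ p in square, evalPoly f p * cubeWeight α β (-(1 / 2)) p) / jacobiMass α β ^ 2 := rfl

open Polynomial in
/-- The polynomial `(1+t)^i (1-t)^j`. The function `(x+y)^(2i) (x-y)^(2j)` is the product of its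
values at `t = cos θ` and `t = cos φ` when `x = cos ((θ-φ)/2)` and `y = cos ((θ+φ)/2)`. -/
def factorPoly (i j : ℕ) : ℝ[X] := (1 - X) ^ j * (1 + X) ^ i

lemma meanL_factorPoly {α β : ℝ} (hα : -1 < α) (hβ : -1 < β) (i j : ℕ) :
    meanL hα hβ (factorPoly i j) = jacobiMass (α + j) (β + i) / jacobiMass α β := by
  rw [meanL_apply]
  congr 1
  refine intervalIntegral.integral_congr fun t ht => ?_
  rw [Set.uIcc_of_le (by norm_num)] at ht
  simp only [factorPoly, jacobiWeight, Polynomial.eval_mul, Polynomial.eval_pow,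
    Polynomial.eval_sub, Polynomial.eval_add, Polynomial.eval_one, Polynomial.eval_X]
  rw [← rpow_mul_pow (by linarith [ht.2]) hα, ← rpow_mul_pow (by linarith [ht.1]) hβ]
  ring

lemma squareL_diagMonomial_even {α β : ℝ} (hα : -1 < α) (hβ : -1 < β) (i j : ℕ) :
    squareL hα hβ (diagMonomial (2 * i) (2 * j)) = meanL hα hβ (factorPoly i j) ^ 2 := by
  rw [squareL_apply, meanL_factorPoly, div_pow]
  simp only [evalPoly_diagMonomial, pow_mul_cubeWeight hα hβ]
  rw [integral_cubeWeight]
  · have : (0 : ℝ) ≤ j := by positivity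
    linarith
  · have : (0 : ℝ) ≤ i := by positivity
    linarith

lemma squareL_diagMonomial_odd {α β : ℝ} (hα : -1 < α) (hβ : -1 < β) {i j : ℕ}
    (h : Odd i ∨ Odd j) : squareL hα hβ (diagMonomial i j) = 0 := by
  rw [squareL_apply, div_eq_zero_iff]
  left
  by_cases hj : Odd j
  · have hswap := setIntegral_square_swap fun p =>
      evalPoly (diagMonomial i j) p * cubeWeight α β (-(1 / 2)) p
    have : ∀ p : ℝ × ℝ, evalPoly (diagMonomial i j) p.swap =
        -evalPoly (diagMonomial i j) p := by
      intro p
      rw [evalPoly_diagMonomial, evalPoly_diagMonomial, Prod.fst_swap, Prod.snd_swap,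
        add_comm p.2, ← neg_sub p.1 p.2, hj.neg_pow]
      ring
    simp only [this, cubeWeight_swap, neg_mul, integral_neg] at hswap
    linarith
  · have hi : Odd i := h.resolve_right hj
    rw [Nat.not_odd_iff_even] at hj
    have hneg := setIntegral_square_neg fun p =>
      evalPoly (diagMonomial i j) p * cubeWeight α β (-(1 / 2)) p
    have : ∀ p : ℝ × ℝ, evalPoly (diagMonomial i j) (-p) =
        -evalPoly (diagMonomial i j) p := by
      intro p
      rw [evalPoly_diagMonomial, evalPoly_diagMonomial, Prod.fst_neg, Prod.snd_neg,
        show -p.1 + -p.2 = -(p.1 + p.2) by ring, show -p.1 - -p.2 = -(p.1 - p.2) by ring,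
        hi.neg_pow, hj.neg_pow]
      ring
    simp only [this, cubeWeight_neg, neg_mul, integral_neg] at hneg
    linarith

/-! ### The polynomials of bounded degree are spanned by the `(x+y)^i (x-y)^j` -/

/-- The span of the polynomials `(x+y)^i (x-y)^j` with `i + j ≤ s`. -/
def diagSpan (s : ℕ) : Submodule ℝ (MvPolynomial (Fin 2) ℝ) :=
  Submodule.span ℝ {f | ∃ i j, i + j ≤ s ∧ f = diagMonomial i j}

lemma diagMonomial_mem {i j s : ℕ} (h : i + j ≤ s) : diagMonomial i j ∈ diagSpan s :=
  Submodule.subset_span ⟨i, j, h, rfl⟩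

lemma diagSpan_mono {s t : ℕ} (h : s ≤ t) : diagSpan s ≤ diagSpan t := by
  refine Submodule.span_mono ?_
  rintro f ⟨i, j, hij, rfl⟩
  exact ⟨i, j, hij.trans h, rfl⟩

lemma X_mul_mem_diagSpan {s : ℕ} (n : Fin 2) {f : MvPolynomial (Fin 2) ℝ} (hf : f ∈ diagSpan s) :
    MvPolynomial.X n * f ∈ diagSpan (s + 1) := by
  induction hf using Submodule.span_induction with
  | zero => simp
  | add f g _ _ hf hg =>
    rw [mul_add]
    exact add_mem hf hg
  | smul c f _ hf =>
    rw [mul_smul_comm]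
    exact Submodule.smul_mem _ _ hf
  | mem f hf =>
    obtain ⟨i, j, hij, rfl⟩ := hf
    have h1 : diagMonomial (i + 1) j ∈ diagSpan (s + 1) := diagMonomial_mem (by omega)
    have h2 : diagMonomial i (j + 1) ∈ diagSpan (s + 1) := diagMonomial_mem (by omega)
    have e1 : diagMonomial (i + 1) j =
        (MvPolynomial.X 0 + MvPolynomial.X 1) * diagMonomial i j := by
      rw [diagMonomial, diagMonomial]
      ring
    have e2 : diagMonomial i (j + 1) =
        (MvPolynomial.X 0 - MvPolynomial.X 1) * diagMonomial i j := by
      rw [diagMonomial, diagMonomial]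
      ring
    have key : (2 : ℝ) • (MvPolynomial.X n * diagMonomial i j) ∈ diagSpan (s + 1) := by
      fin_cases n
      · have : (2 : ℝ) • (MvPolynomial.X 0 * diagMonomial i j) =
            diagMonomial (i + 1) j + diagMonomial i (j + 1) := by
          rw [e1, e2, two_smul]
          ring
        simp only [Fin.zero_eta, this]
        exact add_mem h1 h2
      · have : (2 : ℝ) • (MvPolynomial.X 1 * diagMonomial i j) =
            diagMonomial (i + 1) j - diagMonomial i (j + 1) := by
          rw [e1, e2, two_smul]
          ring
        simp only [Fin.mk_one, this]
        exact sub_mem h1 h2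
    have := Submodule.smul_mem _ (2⁻¹ : ℝ) key
    rwa [smul_smul, inv_mul_cancel₀ (two_ne_zero), one_smul] at this

lemma X_pow_mul_X_pow_mem_diagSpan (a b : ℕ) :
    (MvPolynomial.X 0 ^ a * MvPolynomial.X 1 ^ b : MvPolynomial (Fin 2) ℝ) ∈ diagSpan (a + b) := by
  induction a with
  | zero =>
    induction b with
    | zero =>
      have := diagMonomial_mem (i := 0) (j := 0) (s := 0) le_rfl
      simpa [diagMonomial] using this
    | succ b ih =>
      have := X_mul_mem_diagSpan 1 ih
      rw [pow_zero, one_mul] at this ⊢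
      rw [pow_succ']
      exact this
  | succ a ih =>
    have := X_mul_mem_diagSpan 0 ih
    rw [pow_succ', mul_assoc, show a + 1 + b = a + b + 1 by ring]
    exact this

/-- Every polynomial of degree at most `s` is a combination of the `(x+y)^i (x-y)^j` with
`i + j ≤ s`. -/
lemma mem_diagSpan {f : MvPolynomial (Fin 2) ℝ} {s : ℕ} (hf : f.totalDegree ≤ s) :
    f ∈ diagSpan s := by
  rw [f.as_sum]
  refine Submodule.sum_mem _ fun d hd => ?_
  have hdeg : d 0 + d 1 ≤ s := by
    have := (MvPolynomial.le_totalDegree hd).trans hf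
    rwa [Finsupp.sum_fintype _ _ (fun _ => rfl), Fin.sum_univ_two] at this
  have : MvPolynomial.monomial d (MvPolynomial.coeff d f) =
      MvPolynomial.coeff d f • (MvPolynomial.X 0 ^ d 0 * MvPolynomial.X 1 ^ d 1) := by
    rw [MvPolynomial.monomial_eq, Finsupp.prod_fintype _ _ (fun _ => pow_zero _),
      Fin.prod_univ_two, MvPolynomial.smul_eq_C_mul]
  rw [this]
  exact Submodule.smul_mem _ _ (diagSpan_mono hdeg (X_pow_mul_X_pow_mem_diagSpan _ _))

/-! ### The rule on the products `(x+y)^i (x-y)^j` -/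

lemma sum_Iic_halved {m : ℕ} {A : Fin (m + 1) → Fin (m + 1) → ℝ} (hA : ∀ j k, A j k = A k j) :
    ∑ k, ∑ j ∈ Finset.Iic k, (if j = k then (1 / 2 : ℝ) else 1) * A j k =
      1 / 2 * ∑ k, ∑ j, A j k := by
  have e1 : ∑ k, ∑ j ∈ Finset.Iic k, (if j = k then (1 / 2 : ℝ) else 1) * A j k =
      ∑ k, ∑ j, if j ≤ k then (if j = k then (1 / 2 : ℝ) else 1) * A j k else 0 := by
    refine Finset.sum_congr rfl fun k _ => ?_
    rw [← Finset.sum_filter]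
    refine Finset.sum_congr ?_ fun _ _ => rfl
    ext j
    simp
  have e2 := e1
  rw [Finset.sum_comm (s := Finset.univ (α := Fin (m + 1))) (t := Finset.univ (α := Fin (m + 1)))]
    at e2
  have e3 : ∑ k, ∑ j, A j k =
      (∑ k, ∑ j, if j ≤ k then (if j = k then (1 / 2 : ℝ) else 1) * A j k else 0) +
      ∑ k, ∑ j, if k ≤ j then (if k = j then (1 / 2 : ℝ) else 1) * A k j else 0 := by
    rw [← Finset.sum_add_distrib]
    refine Finset.sum_congr rfl fun k _ => ?_
    rw [← Finset.sum_add_distrib]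
    refine Finset.sum_congr rfl fun j _ => ?_
    rcases lt_trichotomy j k with h | h | h
    · simp [h.le, h.ne, h.not_ge]
    · subst h
      simp
      ring
    · simp [h.le, h.ne, h.not_ge, hA j k]
  rw [e3, ← e2, ← e1]
  ring

section rule

variable {α β : ℝ} {m : ℕ} {θ : Fin (m + 1) → ℝ}

lemma sNode_add_tNode_sq (θ : Fin (m + 1) → ℝ) (j k : Fin (m + 1)) :
    (sNode θ j k + tNode θ j k) ^ 2 = (1 + Real.cos (θ j)) * (1 + Real.cos (θ k)) := by
  have h1 : Real.cos (θ j) = 2 * Real.cos (θ j / 2) ^ 2 - 1 := by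
    rw [← Real.cos_two_mul, mul_div_cancel₀ _ two_ne_zero]
  have h2 : Real.cos (θ k) = 2 * Real.cos (θ k / 2) ^ 2 - 1 := by
    rw [← Real.cos_two_mul, mul_div_cancel₀ _ two_ne_zero]
  rw [sNode, tNode, sub_div, add_div, Real.cos_sub, Real.cos_add, h1, h2]
  ring

lemma sNode_sub_tNode_sq (θ : Fin (m + 1) → ℝ) (j k : Fin (m + 1)) :
    (sNode θ j k - tNode θ j k) ^ 2 = (1 - Real.cos (θ j)) * (1 - Real.cos (θ k)) := by
  have h1 : Real.cos (θ j) = 1 - 2 * Real.sin (θ j / 2) ^ 2 := by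
    rw [Real.sin_sq, ← mul_div_cancel₀ (θ j) (two_ne_zero (α := ℝ)), Real.cos_two_mul]
    ring_nf
  have h2 : Real.cos (θ k) = 1 - 2 * Real.sin (θ k / 2) ^ 2 := by
    rw [Real.sin_sq, ← mul_div_cancel₀ (θ k) (two_ne_zero (α := ℝ)), Real.cos_two_mul]
    ring_nf
  rw [sNode, tNode, sub_div, add_div, Real.cos_sub, Real.cos_add, h1, h2]
  ring

lemma orbitSum_diagMonomial (i n : ℕ) (j k : Fin (m + 1)) :
    orbitSum θ (evalPoly (diagMonomial i n)) j k = (1 + (-1) ^ i) * (1 + (-1) ^ n) *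
      ((sNode θ j k + tNode θ j k) ^ i * (sNode θ j k - tNode θ j k) ^ n) := by
  simp only [orbitSum, evalPoly_diagMonomial]
  set s := sNode θ j k
  set t := tNode θ j k
  rw [show t - s = -1 * (s - t) by ring, show t + s = s + t by ring,
    show -s + -t = -1 * (s + t) by ring, show -s - -t = -1 * (s - t) by ring,
    show -t + -s = -1 * (s + t) by ring, show -t - -s = s - t by ring, mul_pow (-1) (s + t),
    mul_pow (-1) (s - t)]
  ring

variable (α β θ) in
/-- The rule for `γ = -1/2` as a linear functional on polynomials. -/
def ruleL : MvPolynomial (Fin 2) ℝ →ₗ[ℝ] ℝ where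
  toFun f := ruleMinus θ α β (evalPoly f)
  map_add' f g := by
    simp only [ruleMinus, orbitSum, evalPoly, map_add]
    rw [← mul_add, ← Finset.sum_add_distrib]
    congr 1
    refine Finset.sum_congr rfl fun k _ => ?_
    rw [← Finset.sum_add_distrib]
    refine Finset.sum_congr rfl fun j _ => ?_
    ring
  map_smul' c f := by
    simp only [ruleMinus, orbitSum, evalPoly, MvPolynomial.smul_eval, RingHom.id_apply,
      smul_eq_mul, Finset.mul_sum]
    refine Finset.sum_congr rfl fun k _ => Finset.sum_congr rfl fun j _ => ?_
    ring

lemma ruleL_apply (f : MvPolynomial (Fin 2) ℝ) :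
    ruleL α β θ f = ruleMinus θ α β (evalPoly f) := rfl

lemma ruleL_diagMonomial_even (i n : ℕ) :
    ruleL α β θ (diagMonomial (2 * i) (2 * n)) = radauL α β θ (factorPoly i n) ^ 2 := by
  set a : Fin (m + 1) → ℝ := fun k =>
    radauWeight α β m θ k * (factorPoly i n).eval (Real.cos (θ k))
  have h : ∀ j k, (if j = k then (1 / 2 : ℝ) else 1) *
      (radauWeight α β m θ k * radauWeight α β m θ j) *
        orbitSum θ (evalPoly (diagMonomial (2 * i) (2 * n))) j k =
      (if j = k then (1 / 2 : ℝ) else 1) * (4 * (a j * a k)) := by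
    intro j k
    rw [orbitSum_diagMonomial, pow_mul, pow_mul, pow_mul, pow_mul, sNode_add_tNode_sq,
      sNode_sub_tNode_sq, mul_assoc]
    congr 1
    simp only [a, factorPoly, Polynomial.eval_mul, Polynomial.eval_pow, Polynomial.eval_sub,
      Polynomial.eval_add, Polynomial.eval_one, Polynomial.eval_X, mul_pow, neg_one_sq, one_pow]
    ring
  rw [ruleL_apply, ruleMinus]
  simp_rw [h]
  rw [sum_Iic_halved (A := fun j k => 4 * (a j * a k)) fun j k => by ring, radauL_apply]
  have hsum : ∑ k, ∑ j, 4 * (a j * a k) = 4 * (∑ k, a k) ^ 2 := by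
    simp_rw [sq, Finset.sum_mul_sum, Finset.mul_sum]
    exact Finset.sum_comm
  rw [hsum]
  ring

lemma ruleL_diagMonomial_odd {i n : ℕ} (h : Odd i ∨ Odd n) :
    ruleL α β θ (diagMonomial i n) = 0 := by
  have h0 : (1 + (-1 : ℝ) ^ i) * (1 + (-1) ^ n) = 0 := by
    rcases h with h | h <;> simp [h.neg_one_pow]
  simp [ruleL_apply, ruleMinus, orbitSum_diagMonomial, h0]

lemma natDegree_factorPoly_le (i n : ℕ) : (factorPoly i n).natDegree ≤ i + n := by
  have h1 : (1 - Polynomial.X : Polynomial ℝ).natDegree ≤ 1 := by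
    rw [← Polynomial.natDegree_neg, neg_sub, ← Polynomial.C_1]
    exact (Polynomial.natDegree_X_sub_C _).le
  have h2 : (1 + Polynomial.X : Polynomial ℝ).natDegree ≤ 1 := by
    rw [add_comm, ← Polynomial.C_1]
    exact (Polynomial.natDegree_X_add_C _).le
  refine Polynomial.natDegree_mul_le.trans ?_
  have e1 := Polynomial.natDegree_pow_le_of_le n h1
  have e2 := Polynomial.natDegree_pow_le_of_le i h2
  omega

/-- Exactness up to degree `4m+1`: the squares of the one-variable means and Radau sums agree as
only the factors of degree at most `2m` occur. -/
lemma squareL_eq_ruleL (hα : -1 < α) (hβ : -1 < β) (h : IsRadauAngles α β m θ)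
    {f : MvPolynomial (Fin 2) ℝ} (hf : f.totalDegree ≤ 4 * m + 1) :
    squareL hα hβ f = ruleL α β θ f := by
  refine LinearMap.eqOn_span (R := ℝ) ?_ (mem_diagSpan hf)
  rintro _ ⟨i, j, hij, rfl⟩
  by_cases hodd : Odd i ∨ Odd j
  · rw [squareL_diagMonomial_odd hα hβ hodd, ruleL_diagMonomial_odd hodd]
  · push Not at hodd
    rw [Nat.not_odd_iff_even, Nat.not_odd_iff_even] at hodd
    obtain ⟨⟨a, rfl⟩, b, rfl⟩ := hodd
    rw [← two_mul, ← two_mul, squareL_diagMonomial_even, ruleL_diagMonomial_even,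
      meanL_eq_radauL hα hβ h ((natDegree_factorPoly_le a b).trans (by omega))]

lemma factorPoly_pos (hα : -1 < α) (hβ : -1 < β) (i n : ℕ) :
    0 < meanL hα hβ (factorPoly i n) := by
  rw [meanL_factorPoly]
  have h1 : (0 : ℝ) ≤ n := by positivity
  have h2 : (0 : ℝ) ≤ i := by positivity
  exact div_pos (jacobiMass_pos (by linarith) (by linarith)) (jacobiMass_pos hα hβ)

lemma totalDegree_diagMonomial_le (i j : ℕ) : (diagMonomial i j).totalDegree ≤ i + j := by
  have h0 : (MvPolynomial.X 0 + MvPolynomial.X 1 : MvPolynomial (Fin 2) ℝ).totalDegree ≤ 1 :=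
    (MvPolynomial.totalDegree_add _ _).trans (by simp)
  have h1 : (MvPolynomial.X 0 - MvPolynomial.X 1 : MvPolynomial (Fin 2) ℝ).totalDegree ≤ 1 :=
    (MvPolynomial.totalDegree_sub _ _).trans (by simp)
  refine (MvPolynomial.totalDegree_mul _ _).trans (add_le_add ?_ ?_)
  · exact (MvPolynomial.totalDegree_pow _ _).trans (by nlinarith)
  · exact (MvPolynomial.totalDegree_pow _ _).trans (by nlinarith)

lemma squareL_ne_ruleL (hα : -1 < α) (hβ : -1 < β) (h : IsRadauAngles α β m θ) :
    squareL hα hβ (diagMonomial (4 * m + 2) 0) ≠ ruleL α β θ (diagMonomial (4 * m + 2) 0) := by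
  rw [show 4 * m + 2 = 2 * (2 * m + 1) by ring, show 0 = 2 * 0 by rfl, squareL_diagMonomial_even,
    ruleL_diagMonomial_even]
  have hM := factorPoly_pos hα hβ (2 * m + 1) 0
  have hQ : 0 ≤ radauL α β θ (factorPoly (2 * m + 1) 0) := by
    rw [radauL_apply]
    refine Finset.sum_nonneg fun k _ => mul_nonneg (radauWeight_pos hα hβ h k).le ?_
    have := h.neg_one_lt_cos k
    simp only [factorPoly, pow_zero, one_mul, Polynomial.eval_pow, Polynomial.eval_add,
      Polynomial.eval_one, Polynomial.eval_X]
    exact pow_nonneg (by linarith) _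
  have hne := meanL_ne_radauL hα hβ h
  rw [Ne, pow_left_inj₀ hM.le hQ two_ne_zero]
  simpa [factorPoly] using hne

/-! ### The factor `(1-x²)(1-y²)` relating the weights with `γ = ±1/2` -/

open MvPolynomial in
/-- The polynomial `(1-x²)(1-y²)`. -/
def boundaryPoly : MvPolynomial (Fin 2) ℝ := (1 - X 0 ^ 2) * (1 - X 1 ^ 2)

lemma evalPoly_boundaryPoly_mul (f : MvPolynomial (Fin 2) ℝ) (p : ℝ × ℝ) :
    evalPoly (boundaryPoly * f) p = (1 - p.1 ^ 2) * (1 - p.2 ^ 2) * evalPoly f p := by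
  simp [evalPoly, boundaryPoly]

lemma boundaryPoly_eq : boundaryPoly = diagMonomial 0 0 -
    (1 / 2 : ℝ) • (diagMonomial 2 0 + diagMonomial 0 2) +
    (1 / 16 : ℝ) • (diagMonomial 4 0 - (2 : ℝ) • diagMonomial 2 2 + diagMonomial 0 4) := by
  refine MvPolynomial.funext fun x => ?_
  simp only [boundaryPoly, diagMonomial, map_mul, map_sub, map_add, map_pow, map_one,
    MvPolynomial.eval_X, MvPolynomial.smul_eval]
  ring

lemma totalDegree_boundaryPoly_le : boundaryPoly.totalDegree ≤ 4 := by
  have h : ∀ n : Fin 2, (1 - MvPolynomial.X n ^ 2 : MvPolynomial (Fin 2) ℝ).totalDegree ≤ 2 :=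
    fun n => (MvPolynomial.totalDegree_sub _ _).trans (by simp)
  exact (MvPolynomial.totalDegree_mul _ _).trans (add_le_add (h 0) (h 1))

lemma squareL_boundaryPoly (hα : -1 < α) (hβ : -1 < β) : squareL hα hβ boundaryPoly =
    2 * (α + 1) * (β + 1) / ((α + β + 2) ^ 2 * (α + β + 3)) := by
  have e00 := squareL_diagMonomial_even hα hβ 0 0
  have e10 := squareL_diagMonomial_even hα hβ 1 0
  have e01 := squareL_diagMonomial_even hα hβ 0 1
  have e20 := squareL_diagMonomial_even hα hβ 2 0
  have e11 := squareL_diagMonomial_even hα hβ 1 1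
  have e02 := squareL_diagMonomial_even hα hβ 0 2
  simp only [factorPoly, meanL_moment, ascPochhammer_zero, ascPochhammer_one, Polynomial.eval_one,
    Polynomial.eval_X, ascPochhammer_succ_eval, Nat.cast_one, mul_zero, mul_one,
    zero_add, add_zero, Nat.reduceMul, Nat.reduceAdd, show (2 : ℕ) = 1 + 1 from rfl]
    at e00 e10 e01 e20 e11 e02
  rw [boundaryPoly_eq]
  simp only [map_add, map_sub, map_smul, smul_eq_mul]
  norm_num at e00 e10 e01 e20 e11 e02
  rw [e00, e10, e01, e20, e11, e02]
  have h2 : α + β + 2 ≠ 0 := by linarith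
  have h3 : α + β + 3 ≠ 0 := by linarith
  have h4 : α + β + 2 + 1 ≠ 0 := by linarith
  field_simp
  ring

lemma cubeWeight_half {p : ℝ × ℝ} (hp : p ∈ square) : cubeWeight α β (1 / 2) p =
    (1 - p.1 ^ 2) * (1 - p.2 ^ 2) * cubeWeight α β (-(1 / 2)) p := by
  have hx : 0 ≤ 1 - p.1 ^ 2 := by nlinarith [hp.1.1, hp.1.2]
  have hy : 0 ≤ 1 - p.2 ^ 2 := by nlinarith [hp.2.1, hp.2.2]
  have h : ∀ c : ℝ, 0 ≤ c → c ^ (1 / 2 : ℝ) = c ^ (-(1 / 2) : ℝ) * c := by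
    intro c hc
    have := rpow_mul_pow hc (show (-1 : ℝ) < -(1 / 2) by norm_num) 1
    rw [pow_one] at this
    rw [this]
    norm_num
  rw [cubeWeight, cubeWeight, h _ hx, h _ hy]
  ring

lemma evalPoly_mul_cubeWeight_half (f : MvPolynomial (Fin 2) ℝ) {p : ℝ × ℝ} (hp : p ∈ square) :
    evalPoly f p * cubeWeight α β (1 / 2) p =
      evalPoly (boundaryPoly * f) p * cubeWeight α β (-(1 / 2)) p := by
  rw [cubeWeight_half hp, evalPoly_boundaryPoly_mul]
  ring

lemma integral_evalPoly_normCubeWeight_neg (hα : -1 < α) (hβ : -1 < β)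
    (f : MvPolynomial (Fin 2) ℝ) :
    ∫ p in square, evalPoly f p * normCubeWeight α β (-(1 / 2)) p = squareL hα hβ f := by
  simp only [normCubeWeight, ← mul_div_assoc]
  rw [integral_div, integral_cubeWeight hα hβ, squareL_apply]

lemma integral_evalPoly_cubeWeight_half (hα : -1 < α) (hβ : -1 < β)
    (f : MvPolynomial (Fin 2) ℝ) :
    ∫ p in square, evalPoly f p * cubeWeight α β (1 / 2) p =
      squareL hα hβ (boundaryPoly * f) * jacobiMass α β ^ 2 := by
  rw [squareL_apply, div_mul_cancel₀ _ (pow_ne_zero 2 (jacobiMass_pos hα hβ).ne')]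
  exact setIntegral_congr_fun measurableSet_square fun p hp => evalPoly_mul_cubeWeight_half f hp

lemma integral_evalPoly_normCubeWeight_half (hα : -1 < α) (hβ : -1 < β)
    (f : MvPolynomial (Fin 2) ℝ) :
    ∫ p in square, evalPoly f p * normCubeWeight α β (1 / 2) p =
      (α + β + 2) ^ 2 * (α + β + 3) / (2 * (α + 1) * (β + 1)) *
        squareL hα hβ (boundaryPoly * f) := by
  have h1 := integral_evalPoly_cubeWeight_half hα hβ 1
  rw [mul_one, squareL_boundaryPoly] at h1
  simp only [evalPoly, map_one, one_mul] at h1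
  simp only [normCubeWeight, ← mul_div_assoc]
  rw [integral_div, integral_evalPoly_cubeWeight_half hα hβ, h1]
  have := (jacobiMass_pos hα hβ).ne'
  have h2 : α + β + 2 ≠ 0 := by linarith
  have h3 : α + β + 3 ≠ 0 := by linarith
  have h4 : α + 1 ≠ 0 := by linarith
  have h5 : β + 1 ≠ 0 := by linarith
  field_simp

lemma four_mul_boundary_node (θ : Fin (m + 1) → ℝ) (j k : Fin (m + 1)) :
    (Real.cos (θ j) - Real.cos (θ k)) ^ 2 =
      4 * ((1 - sNode θ j k ^ 2) * (1 - tNode θ j k ^ 2)) := by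
  have h1 := sNode_add_tNode_sq θ j k
  have h2 := sNode_sub_tNode_sq θ j k
  set s := sNode θ j k
  set t := tNode θ j k
  set u := Real.cos (θ j)
  set v := Real.cos (θ k)
  have e1 : u + v = 2 * (s * t) := by linear_combination (h2 - h1) / 2
  have e2 : u * v = s ^ 2 + t ^ 2 - 1 := by linear_combination (-h1 - h2) / 2
  linear_combination (u + v + 2 * (s * t)) * e1 - 4 * e2

lemma rulePlus_eq (f : MvPolynomial (Fin 2) ℝ) :
    rulePlus θ α β (evalPoly f) = (α + β + 2) ^ 2 * (α + β + 3) / (2 * (α + 1) * (β + 1)) *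
      ruleL α β θ (boundaryPoly * f) := by
  have h : ∀ j k, (if j = k then (1 / 2 : ℝ) else 1) *
      (radauWeight α β m θ k * radauWeight α β m θ j) *
        (Real.cos (θ j) - Real.cos (θ k)) ^ 2 * orbitSum θ (evalPoly f) j k =
      4 * ((if j = k then (1 / 2 : ℝ) else 1) *
        (radauWeight α β m θ k * radauWeight α β m θ j) *
          orbitSum θ (evalPoly (boundaryPoly * f)) j k) := by
    intro j k
    rw [four_mul_boundary_node]
    simp only [orbitSum, evalPoly_boundaryPoly_mul]
    ring
  rw [rulePlus, ruleL_apply, ruleMinus]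
  simp_rw [h, ← Finset.mul_sum]
  rw [show 8 * (α + 1) * (β + 1) = 2 * (α + 1) * (β + 1) * 4 by ring, ← div_div]
  ring

lemma factorPoly_succ (i j : ℕ) :
    factorPoly i (j + 1) = (2 : ℝ) • factorPoly i j - factorPoly (i + 1) j := by
  rw [factorPoly, factorPoly, factorPoly, two_smul]
  ring

lemma boundaryPoly_mul_diagMonomial (i : ℕ) : boundaryPoly * diagMonomial (2 * i) (2 * 0) =
    diagMonomial (2 * i) (2 * 0) - (1 / 2 : ℝ) •
      (diagMonomial (2 * (i + 1)) (2 * 0) + diagMonomial (2 * i) (2 * 1)) +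
    (1 / 16 : ℝ) • (diagMonomial (2 * (i + 2)) (2 * 0) -
      (2 : ℝ) • diagMonomial (2 * (i + 1)) (2 * 1) + diagMonomial (2 * i) (2 * 2)) := by
  refine MvPolynomial.funext fun x => ?_
  simp only [boundaryPoly, diagMonomial, map_mul, map_sub, map_add, map_pow, map_one,
    MvPolynomial.eval_X, MvPolynomial.smul_eval]
  ring

/-- With `ε ≠ 0` the error of the Radau rule at `(1+t)^(2m+1)`, the errors at
`(1+t)^(2m+1-j) (1-t)^j` are `(-1)^j ε`. In the error of the rule for `γ = 1/2` at `(x+y)^(4m-2)`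
the terms `ε²` cancel, and a positive multiple of `ε` remains. -/
lemma squareL_boundaryPoly_mul_ne (hα : -1 < α) (hβ : -1 < β) (hm : 1 ≤ m)
    (h : IsRadauAngles α β m θ) :
    squareL hα hβ (boundaryPoly * diagMonomial (4 * m - 2) 0) ≠
      ruleL α β θ (boundaryPoly * diagMonomial (4 * m - 2) 0) := by
  obtain ⟨n, rfl⟩ : ∃ n, m = n + 1 := ⟨m - 1, by omega⟩
  rw [show 4 * (n + 1) - 2 = 2 * (2 * n + 1) by omega, show 0 = 2 * 0 by rfl,
    boundaryPoly_mul_diagMonomial]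
  simp only [map_add, map_sub, map_smul, smul_eq_mul, squareL_diagMonomial_even,
    ruleL_diagMonomial_even]
  have hex : ∀ i j, i + j ≤ 2 * (n + 1) →
      meanL hα hβ (factorPoly i j) = radauL α β θ (factorPoly i j) := fun i j hij =>
    meanL_eq_radauL hα hβ h ((natDegree_factorPoly_le i j).trans hij)
  have hne : meanL hα hβ (factorPoly (2 * n + 1 + 2) 0) ≠
      radauL α β θ (factorPoly (2 * n + 1 + 2) 0) := by
    have := meanL_ne_radauL hα hβ h
    rw [show 2 * (n + 1) + 1 = 2 * n + 1 + 2 by ring] at this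
    simpa [factorPoly] using this
  have h0 := hex (2 * n + 1) 0 (by omega)
  have h1 := hex (2 * n + 1 + 1) 0 (by omega)
  have h2 := hex (2 * n + 1) 1 (by omega)
  have p0 := factorPoly_pos hα hβ (2 * n + 1 + 2) 0
  have p1 := factorPoly_pos hα hβ (2 * n + 1 + 1) 1
  have p2 := factorPoly_pos hα hβ (2 * n + 1) 2
  have r1 := factorPoly_succ (2 * n + 1 + 1) 0
  have r2 := factorPoly_succ (2 * n + 1) 1
  have m1 := congrArg (meanL hα hβ) r1
  have m2 := congrArg (meanL hα hβ) r2
  have q1 := congrArg (radauL α β θ) r1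
  have q2 := congrArg (radauL α β θ) r2
  simp only [map_sub, map_smul, smul_eq_mul, zero_add, Nat.reduceAdd] at m1 m2 q1 q2
  set M0 := meanL hα hβ (factorPoly (2 * n + 1 + 2) 0)
  set M1 := meanL hα hβ (factorPoly (2 * n + 1 + 1) 1)
  set M2 := meanL hα hβ (factorPoly (2 * n + 1) 2)
  set ε := M0 - radauL α β θ (factorPoly (2 * n + 1 + 2) 0)
  have hε0 : ε ≠ 0 := sub_ne_zero.2 hne
  have t0 : radauL α β θ (factorPoly (2 * n + 1 + 2) 0) = M0 - ε := by ring
  have t1 : radauL α β θ (factorPoly (2 * n + 1 + 1) 1) = M1 + ε := by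
    linear_combination q1 - m1 - 2 * h1
  have t2 : radauL α β θ (factorPoly (2 * n + 1) 2) = M2 - ε := by
    linear_combination q2 - m2 - 2 * h2 - t1
  rw [h0, h1, h2, t0, t1, t2]
  intro heq
  have : ε * (M0 + 2 * M1 + M2) = 0 := by linear_combination 8 * heq
  rcases mul_eq_zero.1 this with h' | h'
  · exact hε0 h'
  · linarith

/-! ### The weights of the rules at their nodes -/

lemma orbitSum_eq_sum {X : Finset (ℝ × ℝ)} {j k : Fin (m + 1)} (h : orbit θ j k ⊆ X)
    (f : ℝ × ℝ → ℝ) :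
    orbitSum θ f j k = ∑ p ∈ X, orbitSum θ (fun q => if q = p then 1 else 0) j k * f p := by
  have key : ∀ q ∈ orbit θ j k, ∑ p ∈ X, (if q = p then 1 else 0) * f p = f q := by
    intro q hq
    simp [h hq]
  simp only [orbitSum, add_mul, Finset.sum_add_distrib]
  rw [key _ (by simp [orbit]), key _ (by simp [orbit]), key _ (by simp [orbit]),
    key _ (by simp [orbit])]

/-- A sum of orbit sums with nonnegative coefficients is a combination of point evaluations with
positive weights at the points of the orbits with a positive coefficient. -/
lemma exists_weights {c : Fin (m + 1) → Fin (m + 1) → ℝ} {X : Finset (ℝ × ℝ)}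
    (hc : ∀ j k, 0 ≤ c j k) (h1 : ∀ k, ∀ j ≤ k, c j k ≠ 0 → orbit θ j k ⊆ X)
    (h2 : ∀ p ∈ X, ∃ k, ∃ j ≤ k, 0 < c j k ∧ p ∈ orbit θ j k) :
    ∃ w : ℝ × ℝ → ℝ, (∀ p ∈ X, w p ≠ 0) ∧ ∀ f : ℝ × ℝ → ℝ,
      ∑ k, ∑ j ∈ Finset.Iic k, c j k * orbitSum θ f j k = ∑ p ∈ X, w p * f p := by
  have hnn : ∀ p : ℝ × ℝ, ∀ j k, 0 ≤ orbitSum θ (fun q => if q = p then 1 else 0) j k := by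
    intro p j k
    unfold orbitSum
    positivity
  refine ⟨fun p => ∑ k, ∑ j ∈ Finset.Iic k, c j k *
    orbitSum θ (fun q => if q = p then 1 else 0) j k, fun p hp => ?_, fun f => ?_⟩
  · obtain ⟨k, j, hjk, hcpos, hpo⟩ := h2 p hp
    have hpos : 0 < orbitSum θ (fun q => if q = p then (1 : ℝ) else 0) j k := by
      simp only [orbit, Finset.mem_insert, Finset.mem_singleton] at hpo
      unfold orbitSum
      rcases hpo with h | h | h | h <;> rw [← h] <;> simp only [if_true] <;> positivity
    refine ne_of_gt (Finset.sum_pos' (fun k _ => Finset.sum_nonneg fun j _ =>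
      mul_nonneg (hc j k) (hnn p j k)) ⟨k, Finset.mem_univ k, ?_⟩)
    exact Finset.sum_pos' (fun j _ => mul_nonneg (hc j k) (hnn p j k))
      ⟨j, Finset.mem_Iic.2 hjk, mul_pos hcpos hpos⟩
  · simp only [Finset.sum_mul]
    rw [Finset.sum_comm]
    refine Finset.sum_congr rfl fun k _ => ?_
    rw [Finset.sum_comm]
    refine Finset.sum_congr rfl fun j hj => ?_
    by_cases hjk : c j k = 0
    · simp [hjk]
    · rw [orbitSum_eq_sum (h1 k j (Finset.mem_Iic.1 hj) hjk) f, Finset.mul_sum]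
      simp only [mul_assoc]

lemma mem_nodesMinus {p : ℝ × ℝ} :
    p ∈ nodesMinus θ ↔ ∃ k, ∃ j ≤ k, p ∈ orbit θ j k := by
  simp [nodesMinus]

lemma mem_nodesPlus {p : ℝ × ℝ} :
    p ∈ nodesPlus θ ↔ ∃ k, ∃ j < k, p ∈ orbit θ j k := by
  simp [nodesPlus]

lemma ruleMinus_weights (hα : -1 < α) (hβ : -1 < β) (h : IsRadauAngles α β m θ) :
    ∃ w : ℝ × ℝ → ℝ, (∀ p ∈ nodesMinus θ, w p ≠ 0) ∧
      ∀ f, ruleMinus θ α β f = ∑ p ∈ nodesMinus θ, w p * f p := by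
  have hμ := radauWeight_pos hα hβ h
  have hpos : ∀ j k, 0 < 1 / 2 * ((if j = k then (1 / 2 : ℝ) else 1) *
      (radauWeight α β m θ k * radauWeight α β m θ j)) := by
    intro j k
    have := mul_pos (hμ k) (hμ j)
    split_ifs <;> positivity
  obtain ⟨w, hw, hf⟩ := exists_weights (θ := θ) (X := nodesMinus θ) (fun j k => (hpos j k).le)
    (fun k j hjk _ p hp => mem_nodesMinus.2 ⟨k, j, hjk, hp⟩) (fun p hp => by
      obtain ⟨k, j, hjk, hp⟩ := mem_nodesMinus.1 hp
      exact ⟨k, j, hjk, hpos j k, hp⟩)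
  refine ⟨w, hw, fun f => ?_⟩
  rw [← hf f, ruleMinus]
  simp only [Finset.mul_sum, mul_assoc]

lemma rulePlus_weights (hα : -1 < α) (hβ : -1 < β) (h : IsRadauAngles α β m θ) :
    ∃ w : ℝ × ℝ → ℝ, (∀ p ∈ nodesPlus θ, w p ≠ 0) ∧
      ∀ f, rulePlus θ α β f = ∑ p ∈ nodesPlus θ, w p * f p := by
  have hμ := radauWeight_pos hα hβ h
  have hc : 0 < (α + β + 2) ^ 2 * (α + β + 3) / (8 * (α + 1) * (β + 1)) := by
    have e1 : 0 < α + β + 2 := by linarith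
    have e2 : 0 < α + β + 3 := by linarith
    have e3 : 0 < α + 1 := by linarith
    have e4 : 0 < β + 1 := by linarith
    positivity
  -- the terms with `j = k` have coefficient `0`, all others a positive one
  set C := (α + β + 2) ^ 2 * (α + β + 3) / (8 * (α + 1) * (β + 1))
  have hhalf : ∀ j k, 0 < (if j = k then (1 / 2 : ℝ) else 1) *
      (radauWeight α β m θ k * radauWeight α β m θ j) := by
    intro j k
    have := mul_pos (hμ k) (hμ j)
    split_ifs <;> positivity
  set c : Fin (m + 1) → Fin (m + 1) → ℝ := fun j k =>
    C * (1 / 2 * ((if j = k then (1 / 2 : ℝ) else 1) *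
      (radauWeight α β m θ k * radauWeight α β m θ j) *
        (Real.cos (θ j) - Real.cos (θ k)) ^ 2))
  have hnn : ∀ j k, 0 ≤ c j k := fun j k => by
    have := hhalf j k
    simp only [c]
    positivity
  have hpos : ∀ j k, j ≠ k → 0 < c j k := fun j k hjk => by
    have h1 := hhalf j k
    have h2 : 0 < (Real.cos (θ j) - Real.cos (θ k)) ^ 2 :=
      sq_pos_of_ne_zero (sub_ne_zero.2 (h.cos_injective.ne hjk))
    simp only [c]
    positivity
  obtain ⟨w, hw, hf⟩ := exists_weights (θ := θ) (X := nodesPlus θ) hnn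
    (fun k j hjk hne p hp => mem_nodesPlus.2 ⟨k, j, lt_of_le_of_ne hjk fun heq => hne (by
      simp [c, heq]), hp⟩) (fun p hp => by
      obtain ⟨k, j, hjk, hp⟩ := mem_nodesPlus.1 hp
      exact ⟨k, j, hjk.le, hpos j k hjk.ne, hp⟩)
  refine ⟨w, hw, fun f => ?_⟩
  rw [← hf f, rulePlus]
  simp only [Finset.mul_sum, c, mul_assoc, C]

/-! ### The number of nodes -/

lemma add_ne_zero_of_isRadauAngles (h : IsRadauAngles α β m θ) (j k : Fin (m + 1)) :
    sNode θ j k + tNode θ j k ≠ 0 := by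
  intro h0
  have := sNode_add_tNode_sq θ j k
  rw [h0, zero_pow two_ne_zero] at this
  have hj := h.neg_one_lt_cos j
  have hk := h.neg_one_lt_cos k
  nlinarith [mul_pos (show 0 < 1 + Real.cos (θ j) by linarith)
    (show 0 < 1 + Real.cos (θ k) by linarith)]

/-- The orbits with `j = 0` lie on the diagonal, which halves the number of their points. -/
lemma card_orbit (h : IsRadauAngles α β m θ) {j k : Fin (m + 1)} (hjk : j ≤ k) :
    (orbit θ j k).card = if j = 0 then 2 else 4 := by
  have hadd := add_ne_zero_of_isRadauAngles h j k
  have hsub := sNode_sub_tNode_sq θ j k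
  unfold orbit
  set s := sNode θ j k
  set t := tNode θ j k
  split_ifs with hj
  · have hst : s = t := by
      rw [hj, h.zero, Real.cos_zero, sub_self, zero_mul] at hsub
      exact sub_eq_zero.1 (pow_eq_zero_iff two_ne_zero |>.1 hsub)
    have ht : t ≠ 0 := by
      intro ht
      rw [hst, ht, add_zero] at hadd
      exact hadd rfl
    have : ({(s, t), (t, s), (-s, -t), (-t, -s)} : Finset (ℝ × ℝ)) = {(t, t), (-t, -t)} := by
      rw [hst]
      simp
    rw [this, Finset.card_pair]
    intro heq
    exact ht (by have := congrArg Prod.fst heq; simp only at this; linarith)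
  · have hk : k ≠ 0 := fun hk => hj (le_antisymm (hk ▸ hjk) (Fin.zero_le j))
    have hst : s ≠ t := by
      intro hst
      rw [hst, sub_self, zero_pow two_ne_zero] at hsub
      have h1 := h.cos_lt_one hj
      have h2 := h.cos_lt_one hk
      exact (mul_pos (sub_pos.2 h1) (sub_pos.2 h2)).ne hsub
    have e1 : ¬(s = -s ∧ t = -t) := by
      rintro ⟨h1, h2⟩
      exact hadd (by linarith)
    have e2 : ¬(t = -t ∧ s = -s) := fun hh => e1 hh.symm
    have e3 : s ≠ -t := fun hh => hadd (by linarith)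
    have e4 : t ≠ -s := fun hh => hadd (by linarith)
    rw [Finset.card_insert_of_notMem, Finset.card_insert_of_notMem,
      Finset.card_insert_of_notMem, Finset.card_singleton]
    · simp [Prod.ext_iff, hst]
    · simp only [Finset.mem_insert, Finset.mem_singleton, Prod.mk.injEq, not_or]
      exact ⟨fun hh => e4 hh.1, e2⟩
    · simp only [Finset.mem_insert, Finset.mem_singleton, Prod.mk.injEq, not_or]
      exact ⟨fun hh => hst hh.1, e1, fun hh => e3 hh.1⟩

/-- A point determines the sum and the product of `cos θ_j` and `cos θ_k`, hence its orbit. -/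
lemma orbit_index_unique (h : IsRadauAngles α β m θ) {p : ℝ × ℝ} {j k j' k' : Fin (m + 1)}
    (hjk : j ≤ k) (hjk' : j' ≤ k') (hp : p ∈ orbit θ j k) (hp' : p ∈ orbit θ j' k') :
    j = j' ∧ k = k' := by
  have key : ∀ {j k : Fin (m + 1)}, p ∈ orbit θ j k →
      (p.1 + p.2) ^ 2 = (1 + Real.cos (θ j)) * (1 + Real.cos (θ k)) ∧
      (p.1 - p.2) ^ 2 = (1 - Real.cos (θ j)) * (1 - Real.cos (θ k)) := by
    intro j k hp
    rw [← sNode_add_tNode_sq, ← sNode_sub_tNode_sq]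
    simp only [orbit, Finset.mem_insert, Finset.mem_singleton] at hp
    rcases hp with rfl | rfl | rfl | rfl <;> constructor <;> ring
  obtain ⟨a1, a2⟩ := key hp
  obtain ⟨b1, b2⟩ := key hp'
  have hinj := h.cos_injective
  set u := Real.cos (θ j)
  set v := Real.cos (θ k)
  set u' := Real.cos (θ j')
  set v' := Real.cos (θ k')
  have hsum : u + v = u' + v' := by linarith
  have hprod : (u - u') * (u - v') = 0 := by
    linear_combination u * hsum + (a1 + a2 - b1 - b2) / 2
  rcases mul_eq_zero.1 hprod with h0 | h0
  · have e1 : u = u' := sub_eq_zero.1 h0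
    have e2 : v = v' := by linarith
    exact ⟨hinj e1, hinj e2⟩
  · have e1 : u = v' := sub_eq_zero.1 h0
    have e2 : v = u' := by linarith
    have i1 : j = k' := hinj e1
    have i2 : k = j' := hinj e2
    have : j = k := le_antisymm hjk (by rw [i1, i2]; exact hjk')
    exact ⟨this.trans i2, (this.symm.trans i1)⟩

lemma card_biUnion_orbit (h : IsRadauAngles α β m θ) {T : Fin (m + 1) → Finset (Fin (m + 1))}
    (hT : ∀ k, T k ⊆ Finset.Iic k) :
    (Finset.univ.biUnion fun k => (T k).biUnion fun j => orbit θ j k).card =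
      ∑ k, ∑ j ∈ T k, if j = 0 then 2 else 4 := by
  rw [Finset.card_biUnion]
  · refine Finset.sum_congr rfl fun k _ => ?_
    rw [Finset.card_biUnion]
    · exact Finset.sum_congr rfl fun j hj => card_orbit h (Finset.mem_Iic.1 (hT k hj))
    · intro j hj j' hj' hne
      rw [Function.onFun, Finset.disjoint_left]
      intro p hp hp'
      exact hne (orbit_index_unique h (Finset.mem_Iic.1 (hT k hj))
        (Finset.mem_Iic.1 (hT k hj')) hp hp').1
  · intro k _ k' _ hne
    rw [Function.onFun, Finset.disjoint_left]
    intro p hp hp'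
    obtain ⟨j, hj, hp⟩ := Finset.mem_biUnion.1 hp
    obtain ⟨j', hj', hp'⟩ := Finset.mem_biUnion.1 hp'
    exact hne (orbit_index_unique h (Finset.mem_Iic.1 (hT k hj))
      (Finset.mem_Iic.1 (hT k' hj')) hp hp').2

lemma sum_Iic_orbit_card (m : ℕ) :
    ∑ k : Fin (m + 1), ∑ j ∈ Finset.Iic k, (if j = 0 then 2 else 4) = 2 * (m + 1) ^ 2 := by
  have h1 : ∀ k : Fin (m + 1), ∑ j ∈ Finset.Iic k, (if j = 0 then 2 else 4) = 4 * (k : ℕ) + 2 := by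
    intro k
    have : ∑ j ∈ Finset.Iic k, ((if j = 0 then 2 else 4) + if j = 0 then 2 else 0) =
        ∑ j ∈ Finset.Iic k, 4 := Finset.sum_congr rfl fun j _ => by split_ifs <;> rfl
    rw [Finset.sum_add_distrib, Finset.sum_ite_eq' (Finset.Iic k) 0 fun _ => 2,
      if_pos (Finset.mem_Iic.2 (Fin.zero_le k)), Finset.sum_const, Fin.card_Iic] at this
    simp only [smul_eq_mul] at this
    omega
  simp_rw [h1]
  rw [Fin.sum_univ_eq_sum_range (fun k => 4 * k + 2)]
  clear h1
  induction m with
  | zero => rfl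
  | succ m ih =>
    rw [Finset.sum_range_succ, ih]
    ring

lemma card_nodesMinus (h : IsRadauAngles α β m θ) :
    (nodesMinus θ).card = nMin (2 * m + 1) + 1 := by
  have h1 := card_biUnion_orbit h fun k => Finset.Subset.refl (Finset.Iic k)
  rw [sum_Iic_orbit_card] at h1
  rw [nodesMinus, h1, nMin, show (2 * m + 1) / 2 = m by omega,
    show (2 * m + 1) * (2 * m + 1 + 1) = (2 * m + 1) * (m + 1) * 2 by ring,
    Nat.mul_div_cancel _ two_pos]
  ring

lemma card_nodesPlus (hm : 1 ≤ m) (h : IsRadauAngles α β m θ) :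
    (nodesPlus θ).card = nMin (2 * m - 1) + 1 := by
  obtain ⟨n, rfl⟩ : ∃ n, m = n + 1 := ⟨m - 1, by omega⟩
  have h1 := card_biUnion_orbit h fun k => Finset.Iio_subset_Iic_self (a := k)
  have h2 := sum_Iic_orbit_card (n + 1)
  simp_rw [← Finset.Iio_insert, Finset.sum_insert Finset.notMem_Iio_self] at h2
  have h3 : ∑ j : Fin (n + 1 + 1), (if j = 0 then 2 else 4) = 4 * n + 6 := by
    rw [Fin.sum_univ_succ]
    simp
    ring
  rw [Finset.sum_add_distrib, h3, ← h1] at h2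
  rw [nodesPlus, nMin, show 2 * (n + 1) - 1 = 2 * n + 1 by omega,
    show (2 * n + 1) / 2 = n by omega,
    show (2 * n + 1) * (2 * n + 1 + 1) = (2 * n + 1) * (n + 1) * 2 by ring,
    Nat.mul_div_cancel _ two_pos]
  nlinarith

/-! ### The two cubature rules -/

lemma isCubatureRule_ruleMinus (hα : -1 < α) (hβ : -1 < β) (h : IsRadauAngles α β m θ) :
    IsCubatureRule square (normCubeWeight α β (-(1 / 2))) (4 * m + 1) (nodesMinus θ)
      (ruleMinus θ α β) where
  weights := ruleMinus_weights hα hβ h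
  integrable f := by
    simp only [normCubeWeight, ← mul_div_assoc]
    exact (integrableOn_evalPoly_mul hα hβ f).div_const _
  exact f hf := by
    rw [integral_evalPoly_normCubeWeight_neg hα hβ, squareL_eq_ruleL hα hβ h hf, ruleL_apply]
  sharp := ⟨diagMonomial (4 * m + 2) 0, totalDegree_diagMonomial_le _ _, by
    rw [integral_evalPoly_normCubeWeight_neg hα hβ, ← ruleL_apply]
    exact squareL_ne_ruleL hα hβ h⟩

lemma isCubatureRule_rulePlus (hα : -1 < α) (hβ : -1 < β) (hm : 1 ≤ m)
    (h : IsRadauAngles α β m θ) :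
    IsCubatureRule square (normCubeWeight α β (1 / 2)) (4 * m - 3) (nodesPlus θ)
      (rulePlus θ α β) where
  weights := rulePlus_weights hα hβ h
  integrable f := by
    simp only [normCubeWeight, ← mul_div_assoc]
    refine Integrable.div_const ?_ _
    exact (integrableOn_evalPoly_mul hα hβ (boundaryPoly * f)).congr_fun
      (fun p hp => (evalPoly_mul_cubeWeight_half f hp).symm) measurableSet_square
  exact f hf := by
    rw [integral_evalPoly_normCubeWeight_half hα hβ, rulePlus_eq, squareL_eq_ruleL hα hβ h]
    refine (MvPolynomial.totalDegree_mul _ _).trans ?_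
    have := totalDegree_boundaryPoly_le
    omega
  sharp := by
    refine ⟨diagMonomial (4 * m - 2) 0, (totalDegree_diagMonomial_le _ _).trans (by omega), ?_⟩
    rw [integral_evalPoly_normCubeWeight_half hα hβ, rulePlus_eq]
    refine fun heq => squareL_boundaryPoly_mul_ne hα hβ hm h (mul_left_cancel₀ ?_ heq)
    have e1 : 0 < α + β + 2 := by linarith
    have e2 : 0 < α + β + 3 := by linarith
    have e3 : 0 < α + 1 := by linarith
    have e4 : 0 < β + 1 := by linarith
    positivity

end rule

end XuCubature

end

theorem mainTheorem2 (α β : ℝ) (hα : -1 < α) (hβ : -1 < β) (m : ℕ) :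
    (∃! θ : Fin (m + 1) → ℝ, XuCubature.IsRadauAngles α β m θ) ∧
    ∀ θ : Fin (m + 1) → ℝ, XuCubature.IsRadauAngles α β m θ →
      -- the numbers `μ_k` are the Gauss-Radau weights
      (∀ f : Polynomial ℝ, f.natDegree ≤ 2 * m →
        XuCubature.jacobiMean α β (fun t => f.eval t) =
          ∑ k, XuCubature.radauWeight α β m θ k * f.eval (Real.cos (θ k))) ∧
      -- the near minimal rule of degree `4m+1` for `𝒲*_{α,β,-1/2}`
      (XuCubature.IsCubatureRule XuCubature.square
          (XuCubature.normCubeWeight α β (-(1 / 2))) (4 * m + 1)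
          (XuCubature.nodesMinus θ) (XuCubature.ruleMinus θ α β) ∧
        (XuCubature.nodesMinus θ).card = XuCubature.nMin (2 * m + 1) + 1) ∧
      -- the near minimal rule of degree `4m-3` for `𝒲*_{α,β,1/2}`
      (1 ≤ m →
        XuCubature.IsCubatureRule XuCubature.square
          (XuCubature.normCubeWeight α β (1 / 2)) (4 * m - 3)
          (XuCubature.nodesPlus θ) (XuCubature.rulePlus θ α β) ∧
        (XuCubature.nodesPlus θ).card = XuCubature.nMin (2 * m - 1) + 1) := by
  refine ⟨XuCubature.existsUnique_isRadauAngles hα hβ m, fun θ h => ⟨fun f hf => ?_,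
    ⟨XuCubature.isCubatureRule_ruleMinus hα hβ h, XuCubature.card_nodesMinus h⟩,
    fun hm => ⟨XuCubature.isCubatureRule_rulePlus hα hβ hm h, XuCubature.card_nodesPlus hm h⟩⟩⟩
  rw [← XuCubature.radauL_apply, ← XuCubature.meanL_eq_radauL hα hβ h hf]
  rfl
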